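/- Let $n \ge 1$ and let $f : \mathbb{Z}_n^2 \to \mathbb{Z}_n$, where $\mathbb{Z}_n = \{0, \dots, n-1\}$, be chosen uniformly at random among the $n^{n^2}$ such maps. The map $f$ is the rule of a one-dimensional cellular automaton: a configuration $\xi_t : \mathbb{Z} \to \mathbb{Z}_n$ is updated by $\xi_{t+1}(x) = f(\xi_t(x-1), \xi_t(x))$ for all $x \in \mathbb{Z}$. A periodic solution of $f$ with temporal period $\tau$ and spatial period $\sigma$ is a trajectory $(\xi_t)_{t \ge 0}$ of $f$ such that $\sigma$ is the smallest integer $p \ge 1$ with $\xi_0(x) = \xi_0(x+p)$ for all $x \in \mathbb{Z}$, and $\tau$ is the smallest integer $q \ge 1$ with $\xi_q = \xi_0$. Fix an integer $\sigma \ge 1$, and let $Y_{\sigma,n} = Y_{\sigma,n}(f) \in \{1, 2, \dots\} \cup \{\infty\}$ be the smallest temporal period of a periodic solution of $f$ with spatial period $\sigma$ (with $Y_{\sigma,n} = \infty$ if there is none). For integers $\tau \ge 1$ put $$\lambda_{\tau,\sigma} = \frac{1}{\tau\sigma} \sum_{d \mid \gcd(\tau,\sigma)} \varphi(d)\, d,$$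 where $\varphi$ is Euler's totient function. Then, as $n \to \infty$, $Y_{\sigma,n}$ converges weakly (in distribution) to a random variable $Y$ with values in $\{1, 2, \dots\}$ whose law is nontrivial (not a point mass) and is given by $$\mathbb{P}(Y \le y) = 1 - \exp\Bigl(-\sum_{\tau=1}^{y} \lambda_{\tau,\sigma}\Bigr), \qquad y = 0, 1, 2, \dots.$$ -/

import Mathlib

open MeasureTheory ProbabilityTheory Filter

namespace RandomCA

/-- A two-neighbor rule `f : ℤ_n² → ℤ_n`, with `ℤ_n = {0, …, n - 1}`. -/
abbrev Rule (n : ℕ) : Type := Fin n × Fin n → Fin n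

/-- A spatial configuration: a state at every site of `ℤ`. -/
abbrev Config (n : ℕ) : Type := ℤ → Fin n

/-- One update of a configuration: `ξ_{t+1}(x) = f (ξ_t (x - 1), ξ_t x)`. -/
def step {n : ℕ} (f : Rule n) (ξ : Config n) : Config n :=
  fun x => f (ξ (x - 1), ξ x)

/-- `σ` is the minimal spatial period of the configuration `ξ`. -/
def HasSpatialPeriod {n : ℕ} (ξ : Config n) (σ : ℕ) : Prop :=
  IsLeast {p : ℕ | 0 < p ∧ ∀ x : ℤ, ξ x = ξ (x + p)} σ

/-- The periodic solutions of `f` with temporal period `τ` and spatial period `σ`, given by their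
space-time configurations `η` (`η t` is the configuration at time `t`). Both periods are minimal.
Space-time translates are listed separately here, which does not affect whether the set is
empty. -/
def periodicSolutions {n : ℕ} (f : Rule n) (τ σ : ℕ) : Set (ℕ → Config n) :=
  {η | (∀ t, η (t + 1) = step f (η t)) ∧
    HasSpatialPeriod (η 0) σ ∧
    IsLeast {q : ℕ | 0 < q ∧ η q = η 0} τ}

/-- The smallest temporal period of a periodic solution of `f` with spatial period `σ`. The infimum
is taken in `ℕ∞`: it is the minimum if a solution of spatial period `σ` exists, and `⊤`
otherwise. -/
noncomputable def minTemporalPeriod (σ n : ℕ) (f : Rule n) : ℕ∞ :=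
  sInf {t : ℕ∞ | ∃ τ : ℕ, t = τ ∧ (periodicSolutions f τ σ).Nonempty}

/-- There is at least one rule for every `n` (for `n = 0`, the empty function). -/
instance instNonemptyRule : (n : ℕ) → Nonempty (Rule n)
  | 0 => ⟨fun p => p.1⟩
  | _ + 1 => ⟨fun _ => 0⟩

/-- The uniform probability measure on the `n ^ (n ^ 2)` rules. -/
noncomputable def ruleMeasure (n : ℕ) : Measure (Rule n) :=
  uniformOn Set.univ

instance instIsProbabilityMeasureRuleMeasure (n : ℕ) : IsProbabilityMeasure (ruleMeasure n) :=
  instIsProbabilityMeasure_uniformOn_univ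

/-- Every set in `ℕ∞` is measurable, in particular every open set. -/
instance instOpensMeasurableSpaceENat : OpensMeasurableSpace ℕ∞ :=
  ⟨fun _ _ => trivial⟩

/-- `λ_{τ,σ} = (1 / (τ σ)) ∑_{d ∣ gcd(τ, σ)} φ(d) d`. -/
noncomputable def periodRate (τ σ : ℕ) : ℝ :=
  (1 / ((τ : ℝ) * (σ : ℝ))) * ∑ d ∈ (Nat.gcd τ σ).divisors, (Nat.totient d : ℝ) * (d : ℝ)

end RandomCA

namespace RandomCA

open Finset BigOperators

/-! ### Uniform random functions and the approximate Poisson recursion -/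

section Expect

variable {D X : Type*} [Fintype D] [DecidableEq D] [Fintype X] [DecidableEq X]

/-! A periodic solution of spatial period `σ` is recorded by a tile: `k + 1` cyclic rows of length
`σ`, the last row being followed by the first one rotated by `r`. If its states are distinct, the
temporal period is `(k + 1) * addOrderOf r`, the rule is prescribed on `m = (k + 1) * σ` pairs, and
a random rule obeys it with probability `n ^ (-m)`. Up to translation there are about `n ^ m / m`
such tiles of each shape, so the mean number of simple tiles of period at most `y` tends to the sum
of `1 / m` over the admissible `(k, r)`. Since `φ(d)` rotations have order `d`, this is the sum of
the rates `λ_{τ,σ}` (`tendsto_simpleMean`).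

The number `N` of simple tiles solving the rule is asymptotically Poisson by size biasing.
Conditioning on a tile `α` means overriding the rule on its pairs, and this raises `N` by exactly
one unless some tile overlapping `α` interferes. An overlapping tile has more new pairs than new
states (`IsSimple.card_image_sdiff_lt`), which costs a factor `1 / n`. Hence `(k + 1) P(N = k + 1) -
E[N] P(N = k)` tends to zero, and with Markov's inequality against escape of mass this forces `P(N =
0)` to tend to `exp (-l)`, where `l` is the limiting mean (`tendsto_exp_neg_of_recursion`).

Conversely, a solution either has more pairs than states, an event of probability `O(1 / n)`
(`prob_hasExcessTile_le`), or its states determine their neighbors and predecessors, and then it is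
built from a simple tile (`exists_isSimple_of_periodicSolution`). So `Y ≤ y` and `N ≠ 0` agree up to
`O(1 / n)`. The rates dominate a harmonic series, so the limit law has no mass at infinity. -/

theorem card_piecewise_fiber (U : Finset D) (h f' : D → X) :
    #{f : D → X | U.piecewise h f = f'} =
      if ∀ u ∈ U, f' u = h u then Fintype.card X ^ #U else 0 := by
  split_ifs with H
  · have : ({f : D → X | U.piecewise h f = f'} : Finset _) =
        Fintype.piFinset (fun u => if u ∈ U then Finset.univ else {f' u}) := by
      ext f
      simp only [mem_filter, mem_univ, true_and, Fintype.mem_piFinset, funext_iff]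
      refine forall_congr' fun u => ?_
      by_cases hu : u ∈ U <;> simp [hu, H]
    rw [this, Fintype.card_piFinset]
    simp [apply_ite]
  · rw [card_eq_zero, filter_eq_empty_iff]
    rintro f - rfl
    exact H fun u hu => by simp [hu]

/-- Conditioning a uniform random function on its values on `U` amounts to overriding them. -/
theorem expect_ite_agree (U : Finset D) (h : D → X) {P : (D → X) → Prop} [DecidablePred P]
    (hP : ∀ f, P f ↔ ∀ u ∈ U, f u = h u) (Φ : (D → X) → ℝ) :
    𝔼 f : D → X, (if P f then Φ f else 0) =
      ((Fintype.card X : ℝ)⁻¹) ^ #U * 𝔼 f : D → X, Φ (U.piecewise h f) := by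
  simp_rw [hP]
  have key : ∑ f : D → X, Φ (U.piecewise h f) =
      (Fintype.card X : ℝ) ^ #U * ∑ f : D → X, (if ∀ u ∈ U, f u = h u then Φ f else 0) := by
    rw [← Finset.sum_fiberwise (s := Finset.univ) (g := fun f => U.piecewise h f), Finset.mul_sum]
    refine Finset.sum_congr rfl fun f' _ => ?_
    rw [Finset.sum_congr rfl (g := fun _ => Φ f') (by simp +contextual), Finset.sum_const,
      card_piecewise_fiber]
    split_ifs <;> simp
  have hne : (Fintype.card X : ℝ) ^ #U ≠ 0 := by
    rcases U.eq_empty_or_nonempty with rfl | ⟨u, -⟩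
    · simp
    · have : Nonempty X := ⟨h u⟩
      exact pow_ne_zero _ (by simp)
  rw [Fintype.expect_eq_sum_div_card, Fintype.expect_eq_sum_div_card, key, inv_pow]
  field_simp

/-- The probability of `P` under the uniform distribution. -/
noncomputable def prob {Ω : Type*} [Fintype Ω] (P : Ω → Prop) : ℝ :=
  open Classical in 𝔼 f : Ω, if P f then 1 else 0

theorem prob_eq {Ω : Type*} [Fintype Ω] (P : Ω → Prop) [DecidablePred P] :
    prob P = 𝔼 f : Ω, if P f then 1 else 0 := by
  rw [prob]
  congr!

theorem prob_nonneg {Ω : Type*} [Fintype Ω] (P : Ω → Prop) : 0 ≤ prob P :=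
  Finset.expect_nonneg fun f _ => by split_ifs <;> norm_num

theorem prob_mono {Ω : Type*} [Fintype Ω] {P Q : Ω → Prop} (h : ∀ f, P f → Q f) :
    prob P ≤ prob Q :=
  Finset.expect_le_expect fun f _ => by
    by_cases hf : P f
    · simp [hf, h f hf]
    · rw [if_neg hf]
      split_ifs <;> norm_num

theorem prob_false {Ω : Type*} [Fintype Ω] {P : Ω → Prop} (h : ∀ f, ¬ P f) : prob P = 0 :=
  Finset.expect_eq_zero fun f _ => if_neg (h f)

theorem sum_prob {Ω κ : Type*} [Fintype Ω] (T : Finset κ) (P : κ → Ω → Prop)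
    [∀ f, DecidablePred (P · f)] :
    ∑ β ∈ T, prob (P β) = 𝔼 f : Ω, (#{β ∈ T | P β f} : ℝ) := by
  have : ∀ β, DecidablePred (P β) := fun β f => inferInstanceAs (Decidable ((P · f) β))
  simp_rw [prob_eq, card_filter, Nat.cast_sum, Nat.cast_ite, Nat.cast_one, Nat.cast_zero]
  exact (expect_sum_comm _ _ _).symm

/-- Union bound. -/
theorem prob_exists_le {Ω κ : Type*} [Fintype Ω] (T : Finset κ) (P : κ → Ω → Prop) :
    prob (fun f => ∃ β ∈ T, P β f) ≤ ∑ β ∈ T, prob (P β) := by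
  classical
  rw [sum_prob, prob_eq]
  refine Finset.expect_le_expect fun f _ => ?_
  split_ifs with h
  · obtain ⟨β, hβ, h⟩ := h
    rw [Nat.one_le_cast, Nat.one_le_iff_ne_zero, card_ne_zero]
    exact ⟨β, mem_filter.2 ⟨hβ, h⟩⟩
  · exact Nat.cast_nonneg _

theorem prob_agree_eq [Nonempty (D → X)] (U : Finset D) (h : D → X) :
    prob (fun f : D → X => ∀ u ∈ U, f u = h u) = ((Fintype.card X : ℝ)⁻¹) ^ #U := by
  rw [prob_eq, expect_ite_agree U h (fun _ => Iff.rfl) fun _ => 1, Fintype.expect_const, mul_one]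

/-- An event which prescribes the values on `U` has probability at most `|X| ^ (-|U|)`. -/
theorem prob_le_of_agree [Nonempty (D → X)] (U : Finset D) (P : (D → X) → Prop)
    (hP : ∀ f f', P f → P f' → ∀ u ∈ U, f u = f' u) :
    prob P ≤ ((Fintype.card X : ℝ)⁻¹) ^ #U := by
  by_cases hex : ∃ h, P h
  · obtain ⟨h, hh⟩ := hex
    rw [← prob_agree_eq U h]
    exact prob_mono fun f hf => hP f h hf hh
  · rw [prob_false fun f hf => hex ⟨f, hf⟩]
    positivity

/-- The number of partial functions `(U α, h α)`, `α ∈ T`, contained in `f`. -/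
noncomputable def occ {ι : Type*} (T : Finset ι) (U : ι → Finset D) (h : ι → D → X)
    (f : D → X) : ℕ :=
  open Classical in #{α ∈ T | ∀ u ∈ U α, f u = h α u}

variable {ι : Type*} (T : Finset ι) (U : ι → Finset D) (h : ι → D → X)

omit [Fintype X] in
theorem occ_eq_zero_iff {f : D → X} : occ T U h f = 0 ↔ ∀ α ∈ T, ¬ ∀ u ∈ U α, f u = h α u := by
  rw [occ, card_eq_zero, filter_eq_empty_iff]

theorem expect_occ [Nonempty (D → X)] :
    𝔼 f : D → X, (occ T U h f : ℝ) = ∑ α ∈ T, ((Fintype.card X : ℝ)⁻¹) ^ #(U α) := by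
  classical
  rw [Finset.sum_congr rfl fun α _ => (prob_agree_eq (U α) (h α)).symm, sum_prob]
  simp only [occ]

theorem sum_prob_occ_eq (K : ℕ) :
    ∑ k ∈ Finset.range (K + 1), prob (fun f : D → X => occ T U h f = k) =
      𝔼 f : D → X, (if occ T U h f ∈ Finset.range (K + 1) then (1 : ℝ) else 0) := by
  simp_rw [prob_eq]
  rw [← expect_sum_comm]
  refine Finset.expect_congr rfl fun f _ => ?_
  rw [← Finset.sum_ite_eq (Finset.range (K + 1)) (occ T U h f) fun _ => (1 : ℝ)]

/-- Markov's inequality for the event that more than `K` of the partial functions occur; it gives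
tightness in the Poisson limit. -/
theorem one_sub_le_sum_prob_occ [Nonempty (D → X)] (K : ℕ) :
    1 - (∑ α ∈ T, ((Fintype.card X : ℝ)⁻¹) ^ #(U α)) / (K + 1) ≤
      ∑ k ∈ Finset.range (K + 1), prob (fun f : D → X => occ T U h f = k) := by
  rw [← expect_occ T U h, sum_prob_occ_eq, Finset.expect_div, sub_le_iff_le_add,
    ← Finset.expect_add_distrib]
  calc (1 : ℝ) = 𝔼 f : D → X, (1 : ℝ) := (Fintype.expect_const 1).symm
    _ ≤ _ := Finset.expect_le_expect fun f _ => ?_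
  have hK : (0 : ℝ) < K + 1 := by positivity
  split_ifs with hk
  · have : (0 : ℝ) ≤ (occ T U h f : ℝ) / (K + 1) := by positivity
    linarith
  · rw [zero_add, one_le_div hK]
    simp only [Finset.mem_range, not_lt] at hk
    exact_mod_cast hk

theorem sum_prob_occ_le [Nonempty (D → X)] (K : ℕ) :
    ∑ k ∈ Finset.range (K + 1), prob (fun f : D → X => occ T U h f = k) ≤ 1 := by
  rw [sum_prob_occ_eq]
  calc _ ≤ 𝔼 f : D → X, (1 : ℝ) := Finset.expect_le_expect fun f _ => ?_
    _ = 1 := Fintype.expect_const 1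
  split_ifs <;> norm_num

/-- Approximate Poisson recursion for the number of contained partial functions. -/
theorem abs_occ_recursion_le {ε : ℝ}
    (h₁ : ∀ α ∈ T, ∑ β ∈ T, prob (fun f : D → X => β ≠ α ∧ ¬ Disjoint (U α) (U β) ∧
      ∀ u ∈ U β, (U α).piecewise (h α) f u = h β u) ≤ ε)
    (h₂ : ∀ α ∈ T, ∑ β ∈ T, prob (fun f : D → X => ¬ Disjoint (U α) (U β) ∧
      ∀ u ∈ U β, f u = h β u) ≤ ε) (hU : ∀ α ∈ T, (U α).Nonempty) (k : ℕ) :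
    |(k + 1) * prob (fun f : D → X => occ T U h f = k + 1) -
      (∑ α ∈ T, ((Fintype.card X : ℝ)⁻¹) ^ #(U α)) *
        prob (fun f : D → X => occ T U h f = k)| ≤
      (∑ α ∈ T, ((Fintype.card X : ℝ)⁻¹) ^ #(U α)) * (2 * ε) := by
  classical
  -- Size biasing: on the event of `k + 1` occurrences, the factor `k + 1` counts the contained `α`,
  -- and conditioning on each of them overrides `f` on `U α`.
  have hsize : (k + 1 : ℝ) * prob (fun f : D → X => occ T U h f = k + 1) =
      ∑ α ∈ T, ((Fintype.card X : ℝ)⁻¹) ^ #(U α) *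
        prob (fun f : D → X => occ T U h ((U α).piecewise (h α) f) = k + 1) := by
    rw [prob_eq, Finset.mul_expect]
    have : ∀ f : D → X, (k + 1 : ℝ) * (if occ T U h f = k + 1 then (1 : ℝ) else 0) =
        ∑ α ∈ T, (if ∀ u ∈ U α, f u = h α u then
          (if occ T U h f = k + 1 then (1 : ℝ) else 0) else 0) := by
      intro f
      by_cases hf : occ T U h f = k + 1
      · simp only [hf, if_true, mul_one, ← Finset.sum_filter, Finset.sum_const, nsmul_eq_mul]
        rw [occ] at hf
        rw [hf]
        push_cast
        rfl
      · simp [hf]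
    simp_rw [this]
    rw [expect_sum_comm]
    refine Finset.sum_congr rfl fun α _ => ?_
    rw [prob_eq, ← expect_ite_agree (U α) (h α) (fun _ => Iff.rfl)
      (fun f => if occ T U h f = k + 1 then (1 : ℝ) else 0)]
  rw [hsize, Finset.sum_mul, Finset.sum_mul, ← Finset.sum_sub_distrib]
  refine (Finset.abs_sum_le_sum_abs _ _).trans (Finset.sum_le_sum fun α hα => ?_)
  rw [← mul_sub, abs_mul, abs_of_nonneg (by positivity : (0 : ℝ) ≤ (_)⁻¹ ^ #(U α))]
  refine mul_le_mul_of_nonneg_left ?_ (by positivity)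
  rw [prob_eq, prob_eq, ← Finset.expect_sub_distrib, two_mul]
  refine (Finset.abs_expect_le _ _).trans (le_trans ?_ (add_le_add (h₁ α hα) (h₂ α hα)))
  rw [sum_prob, sum_prob, ← Finset.expect_add_distrib]
  refine Finset.expect_le_expect fun f _ => ?_
  set T₁ : Finset ι := {β ∈ T | β ≠ α ∧ ¬ Disjoint (U α) (U β) ∧
      ∀ u ∈ U β, (U α).piecewise (h α) f u = h β u} with hT₁
  set T₂ : Finset ι := {β ∈ T | ¬ Disjoint (U α) (U β) ∧ ∀ u ∈ U β, f u = h β u} with hT₂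
  -- Without interfering overlaps before or after overriding, `α` is the only new occurrence. It was
  -- not present before, since it overlaps itself and would lie in `T₂`.
  by_cases h0 : T₁ = ∅ ∧ T₂ = ∅
  · have hocc : occ T U h ((U α).piecewise (h α) f) = occ T U h f + 1 := by
      simp only [hT₁, hT₂, filter_eq_empty_iff] at h0
      have hα' : α ∉ ({β ∈ T | ∀ u ∈ U β, f u = h β u} : Finset ι) := by
        intro hmem
        refine h0.2 hα ⟨?_, (mem_filter.1 hmem).2⟩
        rw [disjoint_self_iff_empty]
        exact (hU α hα).ne_empty
      rw [occ, occ, ← card_insert_of_notMem hα']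
      congr 1
      ext β
      simp only [mem_filter, mem_insert]
      by_cases hβα : β = α
      · subst hβα
        simp only [hα, true_and, true_or, iff_true]
        intro u hu
        simp [hu]
      · by_cases hd : Disjoint (U α) (U β)
        · have : ∀ u ∈ U β, (U α).piecewise (h α) f u = f u := fun u hu =>
            Finset.piecewise_eq_of_notMem _ _ _ (Finset.disjoint_right.1 hd hu)
          simp only [hβα, false_or]
          refine and_congr_right fun _ => forall₂_congr fun u hu => by rw [this u hu]
        · constructor
          · rintro ⟨hT, hβ⟩
            exact absurd ⟨hβα, hd, hβ⟩ (h0.1 hT)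
          · rintro (h' | ⟨hT, hβ⟩)
            · exact absurd h' hβα
            · exact absurd ⟨hd, hβ⟩ (h0.2 hT)
    rw [hocc]
    simp only [add_left_inj, sub_self, abs_zero]
    positivity
  · have h1 : (1 : ℝ) ≤ #T₁ + #T₂ := by
      rw [← card_eq_zero, ← card_eq_zero] at h0
      have : 1 ≤ #T₁ + #T₂ := by omega
      exact_mod_cast this
    refine le_trans ?_ h1
    split_ifs <;> norm_num

end Expect

/-- A sequence of laws on `ℕ` satisfying the Poisson recursion asymptotically, with bounded means,
has Poisson mass at `0` in the limit. -/
theorem tendsto_exp_neg_of_recursion {p : ℕ → ℕ → ℝ} {L : ℕ → ℝ} {l : ℝ}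
    (hp : ∀ n k, 0 ≤ p n k) (hL : Tendsto L atTop (nhds l))
    (hrec : ∀ k : ℕ, Tendsto (fun n => (k + 1) * p n (k + 1) - L n * p n k) atTop (nhds 0))
    (hlow : ∀ n (K : ℕ), 1 - L n / (K + 1) ≤ ∑ k ∈ Finset.range (K + 1), p n k)
    (hup : ∀ n (K : ℕ), ∑ k ∈ Finset.range (K + 1), p n k ≤ 1) :
    Tendsto (fun n => p n 0) atTop (nhds (Real.exp (-l))) := by
  -- Along an ultrafilter `p n 0` has a limit `c` by compactness. The recursion turns this into the
  -- limits `c * l ^ k / k!` for all `k`, and total mass one determines `c`.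
  rw [tendsto_iff_ultrafilter]
  intro g hg
  have hcpt : IsCompact (Set.Icc (0 : ℝ) 1) := isCompact_Icc
  obtain ⟨c, -, hc⟩ := hcpt.ultrafilter_le_nhds (g.map fun n => p n 0) (by
    rw [le_principal_iff]
    refine Filter.mem_map.2 (Filter.Eventually.of_forall fun n => ⟨hp n 0, ?_⟩)
    simpa using hup n 0)
  have hc : Tendsto (fun n => p n 0) g (nhds c) := hc
  have hL' : Tendsto L g (nhds l) := hL.mono_left hg
  have hk : ∀ k : ℕ, Tendsto (fun n => p n k) g (nhds (c * (l ^ k / k.factorial))) := by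
    intro k
    induction k with
    | zero => simpa using hc
    | succ k ih =>
      have := (((hrec k).mono_left hg).add (hL'.mul ih)).const_mul ((k : ℝ) + 1)⁻¹
      have hne : (k : ℝ) + 1 ≠ 0 := by positivity
      refine (this.congr fun n => ?_).trans (le_of_eq ?_)
      · field_simp
        ring
      · congr 1
        rw [Nat.factorial_succ]
        push_cast
        have : (k.factorial : ℝ) ≠ 0 := by positivity
        field_simp
        ring
  have hsum : ∀ K : ℕ, Tendsto (fun n => ∑ k ∈ Finset.range (K + 1), p n k) g
      (nhds (c * ∑ k ∈ Finset.range (K + 1), l ^ k / k.factorial)) := by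
    intro K
    rw [Finset.mul_sum]
    exact tendsto_finsetSum _ fun k _ => hk k
  have hexp : Tendsto (fun K : ℕ => c * ∑ k ∈ Finset.range (K + 1), l ^ k / k.factorial) atTop
      (nhds (c * Real.exp l)) := by
    refine Tendsto.const_mul c ?_
    have := (NormedSpace.expSeries_div_hasSum_exp (𝔸 := ℝ) l).tendsto_sum_nat
    rw [← congrFun Real.exp_eq_exp_ℝ l] at this
    exact this.comp (tendsto_add_atTop_nat 1)
  have hle : c * Real.exp l ≤ 1 :=
    le_of_tendsto' hexp fun K => le_of_tendsto' (hsum K) fun n => hup n K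
  have hge : 1 ≤ c * Real.exp l := by
    have h0 : Tendsto (fun K : ℕ => 1 - l / ((K : ℝ) + 1)) atTop (nhds (1 - 0)) :=
      tendsto_const_nhds.sub
        (tendsto_const_nhds.div_atTop
          (tendsto_atTop_add_const_right _ _ tendsto_natCast_atTop_atTop))
    rw [sub_zero] at h0
    refine le_of_tendsto_of_tendsto' h0 hexp fun K => ?_
    exact le_of_tendsto_of_tendsto' (tendsto_const_nhds.sub (hL'.div_const _)) (hsum K)
      fun n => hlow n K
  have hceq : c = Real.exp (-l) := by
    rw [Real.exp_neg]
    exact eq_inv_of_mul_eq_one_left (le_antisymm hle hge)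
  exact hceq ▸ hc

/-- Summing over `g` the weight `|X| ^ (-k)`, with `k` the number of values of `g` outside `A`. -/
theorem sum_inv_pow_card_image_sdiff_le {X : Type*} [Fintype X] [DecidableEq X] (A : Finset X)
    (m : ℕ) : ∑ g : Fin m → X, ((Fintype.card X : ℝ)⁻¹) ^ #(Finset.univ.image g \ A) ≤
      ((#A + m : ℕ) : ℝ) ^ m := by
  induction m with
  | zero => simp
  | succ m ih =>
    rw [← Fintype.sum_equiv (Fin.consEquiv fun _ => X)
      (fun q => ((Fintype.card X : ℝ)⁻¹) ^
        #(Finset.univ.image (Fin.cons q.1 q.2 : Fin (m + 1) → X) \ A))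
      _ fun _ => rfl, Fintype.sum_prod_type_right]
    have hstep : ∀ g : Fin m → X, ∑ x : X, ((Fintype.card X : ℝ)⁻¹) ^
        #(Finset.univ.image (Fin.cons x g : Fin (m + 1) → X) \ A) ≤
        ((#A + (m + 1) : ℕ) : ℝ) * ((Fintype.card X : ℝ)⁻¹) ^ #(Finset.univ.image g \ A) := by
      intro g
      set R := Finset.univ.image g with hR
      have hRm : #R ≤ m := by simpa using Finset.card_image_le (s := Finset.univ) (f := g)
      have himg : ∀ x, Finset.univ.image (Fin.cons x g : Fin (m + 1) → X) = insert x R := by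
        intro x
        ext z
        simp [hR, Fin.exists_fin_succ, eq_comm]
      set w := (Fintype.card X : ℝ)⁻¹
      have hw : 0 ≤ w := by positivity
      -- An old value `x` costs nothing but has at most `#A + m` choices; a new one has up to `|X|`
      -- choices, each paid for by a factor `w = 1 / |X|`.
      have hb : ∀ x, w ^ #(insert x R \ A) ≤
          (if x ∈ A ∪ R then w ^ #(R \ A) else 0) + w * w ^ #(R \ A) := by
        intro x
        split_ifs with hx
        · have : insert x R \ A = R \ A := by
            rcases mem_union.1 hx with hx | hx
            · rw [insert_sdiff_of_mem _ hx]
            · rw [insert_eq_of_mem hx]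
          rw [this]
          have : 0 ≤ w * w ^ #(R \ A) := by positivity
          linarith
        · simp only [mem_union, not_or] at hx
          rw [insert_sdiff_of_notMem _ hx.1, card_insert_of_notMem (by simp [hx.2]), pow_succ']
          simp
      calc ∑ x : X, w ^ #(Finset.univ.image (Fin.cons x g : Fin (m + 1) → X) \ A)
          ≤ ∑ x : X, ((if x ∈ A ∪ R then w ^ #(R \ A) else 0) + w * w ^ #(R \ A)) :=
            Finset.sum_le_sum fun x _ => by rw [himg]; exact hb x
        _ = #(A ∪ R) * w ^ #(R \ A) + Fintype.card X * (w * w ^ #(R \ A)) := by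
            rw [Finset.sum_add_distrib, Finset.sum_ite_mem, Finset.univ_inter]
            simp
        _ ≤ ((#A + (m + 1) : ℕ) : ℝ) * w ^ #(R \ A) := by
            rw [← mul_assoc, ← add_mul]
            refine mul_le_mul_of_nonneg_right ?_ (by positivity)
            have h1 : (Fintype.card X : ℝ) * w ≤ 1 := mul_inv_le_one
            have h2 : (#(A ∪ R) : ℝ) ≤ #A + m := by
              exact_mod_cast (card_union_le A R).trans (by omega)
            push_cast
            linarith
    refine (Finset.sum_le_sum fun g _ => hstep g).trans ?_
    rw [← Finset.mul_sum, pow_succ']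
    refine mul_le_mul_of_nonneg_left (ih.trans ?_) (by positivity)
    gcongr
    omega

theorem sum_inv_pow_card_image_sdiff_le' {X ι : Type*} [Fintype X] [DecidableEq X] [Fintype ι]
    [DecidableEq ι] (A : Finset X) :
    ∑ g : ι → X, ((Fintype.card X : ℝ)⁻¹) ^ #(Finset.univ.image g \ A) ≤
      ((#A + Fintype.card ι : ℕ) : ℝ) ^ Fintype.card ι := by
  refine le_trans (le_of_eq ?_) (sum_inv_pow_card_image_sdiff_le A (Fintype.card ι))
  refine Fintype.sum_equiv ((Fintype.equivFin ι).arrowCongr (Equiv.refl X)) _ _ fun g => ?_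
  congr 3
  ext z
  simp [Equiv.arrowCongr, (Fintype.equivFin ι).symm.surjective.exists]

/-- Index set of a tile with `k + 1` rows of length `σ`. -/
abbrev TileIndex (k σ : ℕ) : Type := Fin (k + 1) × ZMod σ

/-! ### Tiles, their combinatorics and their pairs of neighbors -/

section Tile

variable {k σ n : ℕ}

/-- Left neighbor in a tile; rows are cyclic. -/
def left (i : TileIndex k σ) : TileIndex k σ := (i.1, i.2 - 1)

/-- Successor in time in a tile whose last row is followed by the first one, rotated by `r`. -/
def down (r : ZMod σ) (i : TileIndex k σ) : TileIndex k σ :=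
  if h : (i.1 : ℕ) + 1 < k + 1 then (⟨i.1 + 1, h⟩, i.2) else (0, i.2 + r)

/-- The index of the space-time point `(t, x)` in the tiling with rotation `r`. -/
def tileAt (r : ZMod σ) (t : ℕ) (x : ZMod σ) : TileIndex k σ :=
  (⟨t % (k + 1), Nat.mod_lt _ k.succ_pos⟩, x + (t / (k + 1)) • r)

/-- The space-time configuration obtained from the tile `g` is a trajectory of `f`. -/
def Solves (r : ZMod σ) (f : Rule n) (g : TileIndex k σ → Fin n) : Prop :=
  ∀ i, f (g (left i), g i) = g (down r i)

theorem left_tileAt (r : ZMod σ) (t : ℕ) (x : ZMod σ) :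
    left (tileAt r t x : TileIndex k σ) = tileAt r t (x - 1) := by
  simp only [left, tileAt, Prod.mk.injEq, true_and]
  ring

theorem down_tileAt (r : ZMod σ) (t : ℕ) (x : ZMod σ) :
    down r (tileAt r t x : TileIndex k σ) = tileAt r (t + 1) x := by
  have hdm := Nat.div_add_mod t (k + 1)
  have hlt : t % (k + 1) < k + 1 := Nat.mod_lt t k.succ_pos
  rw [down]
  split_ifs with h
  all_goals simp only [tileAt] at h ⊢
  · have h1 : (t + 1) % (k + 1) = t % (k + 1) + 1 := by
      rw [← Nat.mod_add_mod, Nat.mod_eq_of_lt h]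
    have h2 : (t + 1) / (k + 1) = t / (k + 1) := by
      conv_lhs => rw [← hdm, add_assoc, Nat.mul_add_div k.succ_pos, Nat.div_eq_of_lt h, add_zero]
    simp [h1, h2]
  · have hk : t % (k + 1) + 1 = k + 1 := by omega
    have h1 : (t + 1) % (k + 1) = 0 := by
      rw [← Nat.mod_add_mod, hk, Nat.mod_self]
    have h2 : (t + 1) / (k + 1) = t / (k + 1) + 1 := by
      conv_lhs => rw [← hdm, add_assoc, Nat.mul_add_div k.succ_pos, hk, Nat.div_self k.succ_pos]
    simp only [h1, h2, add_smul, one_smul, add_assoc]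
    rfl

theorem tileAt_of_lt (r : ZMod σ) {t : ℕ} (ht : t < k + 1) (x : ZMod σ) :
    tileAt r t x = ((⟨t, ht⟩, x) : TileIndex k σ) := by
  simp [tileAt, Nat.mod_eq_of_lt ht, Nat.div_eq_of_lt ht]

theorem tileAt_fst_snd (r : ZMod σ) (i : TileIndex k σ) : tileAt r i.1 i.2 = i :=
  tileAt_of_lt r i.1.2 i.2

theorem tileAt_add (r : ZMod σ) (t : ℕ) (x : ZMod σ) :
    (tileAt r (t + (k + 1)) (x - r) : TileIndex k σ) = tileAt r t x := by
  simp [tileAt, Nat.add_div_right _ k.succ_pos, add_smul]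

theorem left_surjective : Function.Surjective (left : TileIndex k σ → TileIndex k σ) :=
  fun i => ⟨(i.1, i.2 + 1), by simp [left]⟩

theorem down_surjective (r : ZMod σ) :
    Function.Surjective (down r : TileIndex k σ → TileIndex k σ) := fun i =>
  -- The predecessor lies `k` steps ahead, one short of a full cycle; starting from `i.2 - r`
  -- cancels the rotation of that cycle.
  ⟨tileAt r (i.1 + k) (i.2 - r), by
    rw [down_tileAt, add_assoc, tileAt_add, tileAt_fst_snd]⟩

theorem forall_of_sub_one [NeZero σ] {S : ZMod σ → Prop} (hS : ∀ x, S x → S (x - 1))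
    {x₀ : ZMod σ} (h₀ : S x₀) (x : ZMod σ) : S x := by
  have : ∀ j : ℕ, S (x₀ - j) := by
    intro j
    induction j with
    | zero => simpa using h₀
    | succ j ih =>
      have := hS _ ih
      rwa [sub_sub, ← Nat.cast_succ] at this
  have h := this (x₀ - x).val
  rwa [ZMod.natCast_zmod_val, sub_sub_cancel] at h

/-- Every index is reached from every other one by moving left and forward in time. -/
theorem forall_of_left_down [NeZero σ] (r : ZMod σ) {S : TileIndex k σ → Prop}
    (hl : ∀ i, S i → S (left i)) (hd : ∀ i, S i → S (down r i)) {i₀ : TileIndex k σ}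
    (h₀ : S i₀) (i : TileIndex k σ) : S i := by
  have hrow : ∀ t x, S (tileAt r t x) → ∀ z, S (tileAt r t z) := fun t x hx z =>
    forall_of_sub_one (S := fun z => S (tileAt r t z))
      (fun z hz => by rw [← left_tileAt]; exact hl _ hz) hx z
  have hall : ∀ j z, S (tileAt r (i₀.1 + j) z) := by
    intro j
    induction j with
    | zero => exact hrow _ i₀.2 (by simpa only [add_zero, tileAt_fst_snd] using h₀)
    | succ j ih =>
      intro z
      rw [← add_assoc, ← down_tileAt]
      exact hd _ (ih z)
  -- This many steps lead to row `i.1` one cycle later, so subtraction is never truncated; the shift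
  -- by `r` compensates the extra cycle.
  have h := hall (k + 1 - i₀.1 + i.1) (i.2 - r)
  have e : (i₀.1 : ℕ) + (k + 1 - i₀.1 + i.1) = i.1 + (k + 1) := by
    have := i₀.1.2
    omega
  rwa [e, tileAt_add, tileAt_fst_snd] at h

variable [NeZero σ]

/-- The pairs of neighboring states occurring in a tile. -/
def pairs (g : TileIndex k σ → Fin n) : Finset (Fin n × Fin n) :=
  Finset.univ.image fun i => (g (left i), g i)

theorem mem_pairs {g : TileIndex k σ → Fin n} {u : Fin n × Fin n} :
    u ∈ pairs g ↔ ∃ i, (g (left i), g i) = u := by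
  simp [pairs]

theorem image_snd_pairs (g : TileIndex k σ → Fin n) :
    (pairs g).image Prod.snd = Finset.univ.image g := by
  simp [pairs, Finset.image_image, Function.comp_def]

theorem image_fst_pairs (g : TileIndex k σ → Fin n) :
    (pairs g).image Prod.fst = Finset.univ.image g := by
  ext c
  simp only [pairs, Finset.image_image, Function.comp_def, mem_image, mem_univ, true_and]
  exact ((left_surjective (k := k) (σ := σ)).exists (p := fun i => g i = c)).symm

theorem Solves.image_pairs {r : ZMod σ} {f : Rule n} {g : TileIndex k σ → Fin n}
    (h : Solves r f g) : (pairs g).image f = Finset.univ.image g := by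
  ext c
  simp only [pairs, Finset.image_image, Function.comp_def, mem_image, mem_univ, true_and, h _]
  exact ((down_surjective (k := k) r).exists (p := fun i => g i = c)).symm

theorem card_image_le_card_pairs (g : TileIndex k σ → Fin n) :
    #(Finset.univ.image g) ≤ #(pairs g) := by
  rw [← image_snd_pairs]
  exact card_image_le

theorem card_pairs_of_injective {g : TileIndex k σ → Fin n} (hg : Function.Injective g) :
    #(pairs g) = (k + 1) * σ := by
  rw [pairs, card_image_of_injective _ fun i j hij => hg (Prod.ext_iff.1 hij).2]
  simp [ZMod.card]

end Tile

/-- Each new second coordinate needs its own new pair. If there are no more new pairs than new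
coordinates, none is left over to end in an old one. -/
theorem mem_of_card_sdiff_le {X : Type*} [DecidableEq X] {P U : Finset (X × X)} {A : Finset X}
    (hU : ∀ u ∈ U, u.2 ∈ A) (hcard : #(P \ U) ≤ #(P.image Prod.snd \ A)) :
    ∀ p ∈ P, p.2 ∈ A → p ∈ U := by
  have hsub : {p ∈ P | p.2 ∉ A} ⊆ P \ U := fun p hp =>
    Finset.mem_sdiff.2 ⟨(mem_filter.1 hp).1, fun hpU => (mem_filter.1 hp).2 (hU p hpU)⟩
  have himg : P.image Prod.snd \ A ⊆ image Prod.snd {p ∈ P | p.2 ∉ A} := fun c hc => by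
    simp only [Finset.mem_sdiff, mem_image] at hc
    obtain ⟨⟨p, hp, rfl⟩, hc⟩ := hc
    exact mem_image_of_mem _ (mem_filter.2 ⟨hp, hc⟩)
  have heq := eq_of_subset_of_card_le hsub
    (hcard.trans ((card_le_card himg).trans card_image_le))
  intro p hp hpA
  by_contra hpU
  have : p ∈ P \ U := Finset.mem_sdiff.2 ⟨hp, hpU⟩
  rw [← heq, mem_filter] at this
  exact this.2 hpA

/-! ### Simple tiles and the rarity of overlaps -/

section Simple

variable {y σ n : ℕ} [NeZero σ]

/-- Tiles with at most `y` rows, together with their rotation. -/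
abbrev Tile (y σ n : ℕ) : Type :=
  Σ q : Fin y × ZMod σ, (TileIndex q.1 σ → Fin n)

/-- Tiles of temporal period at most `y` with distinct states, normalized by translation. -/
def IsSimple (α : Tile y σ n) : Prop :=
  (α.1.1 + 1) * addOrderOf α.1.2 ≤ y ∧ Function.Injective α.2 ∧ ∀ i, α.2 (0, 0) ≤ α.2 i

open Classical in
/-- The finite set of simple tiles. -/
noncomputable def simpleTiles (y σ n : ℕ) [NeZero σ] : Finset (Tile y σ n) := {α | IsSimple α}

/-- A rule solved by the tile `α`, if the states of `α` are distinct. -/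
noncomputable def forced (α : Tile y σ n) : Rule n :=
  -- The default `Prod.fst` is immaterial: only values on `pairs α.2` are ever used.
  Function.extend (fun i => (α.2 (left i), α.2 i)) (fun i => α.2 (down α.1.2 i)) Prod.fst

omit [NeZero σ] in
theorem forced_apply {α : Tile y σ n} (hα : Function.Injective α.2) (i : TileIndex α.1.1 σ) :
    forced α (α.2 (left i), α.2 i) = α.2 (down α.1.2 i) :=
  Function.Injective.extend_apply (f := fun i => (α.2 (left i), α.2 i))
    (fun _ _ hij => hα (Prod.ext_iff.1 hij).2) _ _ i

theorem agree_forced_iff {α : Tile y σ n} (hα : Function.Injective α.2) (f : Rule n) :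
    (∀ u ∈ pairs α.2, f u = forced α u) ↔ Solves α.1.2 f α.2 := by
  simp only [mem_pairs, forall_exists_index, forall_apply_eq_imp_iff, forced_apply hα]
  rfl

theorem mem_simpleTiles {α : Tile y σ n} : α ∈ simpleTiles y σ n ↔ IsSimple α := by
  simp [simpleTiles]

/-- Two simple tiles, one of which embeds into the other compatibly with the dynamics, coincide. -/
theorem IsSimple.eq_of_forall_exists {α β : Tile y σ n} (hα : IsSimple α) (hβ : IsSimple β)
    (h : ∀ i, ∃ j, β.2 i = α.2 j ∧ β.2 (left i) = α.2 (left j) ∧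
      β.2 (down β.1.2 i) = α.2 (down α.1.2 j)) : β = α := by
  obtain ⟨⟨k, r⟩, a⟩ := α
  obtain ⟨⟨k', r'⟩, b⟩ := β
  obtain ⟨-, ha, hamin⟩ := hα
  obtain ⟨-, hb, hbmin⟩ := hβ
  dsimp only at *
  choose φ hφ hφl hφd using h
  have hl : ∀ i, φ (left i) = left (φ i) := fun i => ha ((hφ _).symm.trans (hφl i))
  have hd : ∀ i, φ (down r' i) = down r (φ i) := fun i => ha ((hφ _).symm.trans (hφd i))
  have hinj : Function.Injective φ := fun i j hij => hb (by rw [hφ, hφ, hij])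
  have hsurj : Function.Surjective φ := by
    intro j
    refine forall_of_left_down r (S := fun j => ∃ i, φ i = j) ?_ ?_ ⟨(0, 0), rfl⟩ j
    · rintro _ ⟨i, rfl⟩
      exact ⟨left i, hl i⟩
    · rintro _ ⟨i, rfl⟩
      exact ⟨down r' i, hd i⟩
  have hcard := Fintype.card_of_bijective ⟨hinj, hsurj⟩
  simp only [Fintype.card_prod, Fintype.card_fin, ZMod.card] at hcard
  have hk : k' = k := by
    have := Nat.eq_of_mul_eq_mul_right (NeZero.pos σ) hcard
    exact Fin.ext (by omega)
  subst hk
  -- Both tiles carry their smallest state at the origin, which removes the freedom of translation.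
  -- Equivariance then makes `φ` the identity, and the step from the last row to the first reveals
  -- the rotation.
  have h0 : φ (0, 0) = (0, 0) := by
    obtain ⟨i, hi⟩ := hsurj (0, 0)
    refine ha (le_antisymm ?_ (hamin _))
    have hbi : b i = a (0, 0) := by rw [hφ, hi]
    rw [← hφ, ← hbi]
    exact hbmin i
  have hrow : ∀ {t} (ht : t < (k' : ℕ) + 1) x₀, φ (⟨t, ht⟩, x₀) = (⟨t, ht⟩, x₀) →
      ∀ x, φ (⟨t, ht⟩, x) = (⟨t, ht⟩, x) := by
    intro t ht x₀ hx₀ x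
    refine forall_of_sub_one (S := fun x => φ (⟨t, ht⟩, x) = (⟨t, ht⟩, x)) (fun x hx => ?_) hx₀ x
    have := hl (⟨t, ht⟩, x)
    rwa [hx] at this
  have hid : ∀ t (ht : t < (k' : ℕ) + 1) x, φ (⟨t, ht⟩, x) = (⟨t, ht⟩, x) := by
    intro t
    induction t with
    | zero => exact fun ht => hrow ht 0 h0
    | succ t ih =>
      intro ht
      refine hrow ht 0 ?_
      have := hd (⟨t, by omega⟩, 0)
      rw [ih] at this
      simpa [down, ht] using this
  have hid' : ∀ i, φ i = i := fun i => hid _ i.1.2 i.2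
  have hr : r' = r := by
    have := hd (Fin.last _, 0)
    rw [hid', hid'] at this
    simpa [down] using this
  subst hr
  have hab : b = a := funext fun i => by rw [hφ, hid']
  rw [hab]

theorem exists_eq_of_not_disjoint_pairs {α β : Tile y σ n}
    (h : ¬ Disjoint (pairs α.2) (pairs β.2)) : ∃ i j, β.2 i = α.2 j := by
  obtain ⟨u, hu, hu'⟩ := Finset.not_disjoint_iff.1 h
  obtain ⟨j, hj⟩ := mem_pairs.1 hu
  obtain ⟨i, hi⟩ := mem_pairs.1 hu'
  exact ⟨i, j, (Prod.ext_iff.1 (hi.trans hj.symm)).2⟩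

/-- A simple tile overlapping a different one, both solving `f`, uses more new pairs than new
states. -/
theorem IsSimple.card_image_sdiff_lt {α β : Tile y σ n} (hα : IsSimple α) (hβ : IsSimple β)
    (hne : β ≠ α) (hd : ¬ Disjoint (pairs α.2) (pairs β.2)) {f : Rule n}
    (hfα : Solves α.1.2 f α.2) (hfβ : Solves β.1.2 f β.2) :
    #(Finset.univ.image β.2 \ Finset.univ.image α.2) < #(pairs β.2 \ pairs α.2) := by
  by_contra! hcard
  rw [← image_snd_pairs β.2] at hcard
  -- A state of `β` shared with `α` ends a pair of `α`, so its left neighbor and its successor are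
  -- shared too. Sharing spreads over all of `β`, which must then equal `α`.
  have key : ∀ i, (∃ j, β.2 i = α.2 j) → ∃ j, β.2 i = α.2 j ∧ β.2 (left i) = α.2 (left j) ∧
      β.2 (down β.1.2 i) = α.2 (down α.1.2 j) := by
    rintro i ⟨j, hj⟩
    have hU : ∀ u ∈ pairs α.2, u.2 ∈ Finset.univ.image α.2 := by
      intro u hu
      rw [← image_snd_pairs]
      exact mem_image_of_mem _ hu
    have hmem := mem_of_card_sdiff_le hU hcard (β.2 (left i), β.2 i) (mem_pairs.2 ⟨i, rfl⟩)
      (by simp [hj])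
    obtain ⟨l, hl⟩ := mem_pairs.1 hmem
    refine ⟨l, (Prod.ext_iff.1 hl).2.symm, (Prod.ext_iff.1 hl).1.symm, ?_⟩
    rw [← hfα l, ← hfβ i, hl]
  obtain ⟨i₀, hi₀⟩ := exists_eq_of_not_disjoint_pairs hd
  refine hne (hα.eq_of_forall_exists hβ fun i => key i ?_)
  refine forall_of_left_down β.1.2 (S := fun i => ∃ j, β.2 i = α.2 j) ?_ ?_ hi₀ i
  · intro i hi
    obtain ⟨j, -, hj, -⟩ := key i hi
    exact ⟨_, hj⟩
  · intro i hi
    obtain ⟨j, -, -, hj⟩ := key i hi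
    exact ⟨_, hj⟩

/-- The number of simple tiles solving `f`. -/
noncomputable def simpleCount (y σ : ℕ) [NeZero σ] {n : ℕ} (f : Rule n) : ℕ :=
  occ (simpleTiles y σ n) (fun α => pairs α.2) forced f

/-- The mean number of simple tiles solving a random rule. -/
noncomputable def simpleMean (y σ : ℕ) [NeZero σ] (n : ℕ) : ℝ :=
  ∑ α ∈ simpleTiles y σ n, ((n : ℝ)⁻¹) ^ #(pairs α.2)

/-- The bound is free of `n`: there are `y * σ` shapes, each contributing at most `(#A + m) ^ m`
with `m ≤ y * σ`. The `+ 1` keeps the base positive so that the exponent may be raised. -/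
theorem sum_tile_inv_pow_le (y σ n : ℕ) [NeZero σ] (A : Finset (Fin n)) (hA : #A ≤ y * σ) :
    ∑ β : Tile y σ n, ((n : ℝ)⁻¹) ^ #(Finset.univ.image β.2 \ A) ≤
      (y * σ) * (2 * (y * σ) + 1 : ℕ) ^ (y * σ) := by
  rw [Fintype.sum_sigma]
  refine (Finset.sum_le_card_nsmul _ _ ((2 * (y * σ) + 1 : ℕ) ^ (y * σ) : ℝ) fun q _ => ?_).trans ?_
  · have hq : Fintype.card (TileIndex q.1 σ) ≤ y * σ := by
      simp only [Fintype.card_prod, Fintype.card_fin, ZMod.card]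
      exact Nat.mul_le_mul_right _ q.1.2
    have h := sum_inv_pow_card_image_sdiff_le' (ι := TileIndex q.1 σ) A
    rw [Fintype.card_fin] at h
    refine h.trans ?_
    exact_mod_cast (Nat.pow_le_pow_left (by omega) _).trans (Nat.pow_le_pow_right (by omega) hq)
  · simp [ZMod.card]

theorem card_image_tile_le (α : Tile y σ n) : #(Finset.univ.image α.2) ≤ y * σ := by
  refine card_image_le.trans ?_
  simp only [Finset.card_univ, Fintype.card_prod, Fintype.card_fin, ZMod.card]
  exact Nat.mul_le_mul_right _ α.1.1.2

theorem sum_prob_tile_le (P : Tile y σ n → Rule n → Prop) (A : Finset (Fin n))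
    (hA : #A ≤ y * σ)
    (hP : ∀ β, prob (P β) ≤ (n : ℝ)⁻¹ * ((n : ℝ)⁻¹) ^ #(Finset.univ.image β.2 \ A))
    (T : Finset (Tile y σ n)) :
    ∑ β ∈ T, prob (P β) ≤ (n : ℝ)⁻¹ * ((y * σ) * (2 * (y * σ) + 1 : ℕ) ^ (y * σ)) := by
  refine (Finset.sum_le_sum fun β _ => hP β).trans ?_
  rw [← Finset.mul_sum]
  refine mul_le_mul_of_nonneg_left ?_ (by positivity)
  exact (Finset.sum_le_univ_sum_of_nonneg fun β => by positivity).trans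
    (sum_tile_inv_pow_le y σ n A hA)

theorem inv_pow_le_of_lt {a b : ℕ} (h : a < b) :
    ((n : ℝ)⁻¹) ^ b ≤ (n : ℝ)⁻¹ * ((n : ℝ)⁻¹) ^ a := by
  rw [← pow_succ']
  exact pow_le_pow_of_le_one (by positivity) (Nat.cast_inv_le_one n) h

/-- Both kinds of interfering tiles prescribe more values of the rule than they have states outside
`α`, which leaves a factor `1 / n` after summation over all tiles. -/
theorem abs_simpleCount_recursion_le (y σ n : ℕ) [NeZero σ] (k : ℕ) :
    |(k + 1) * prob (fun f : Rule n => simpleCount y σ f = k + 1) -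
      simpleMean y σ n * prob (fun f : Rule n => simpleCount y σ f = k)| ≤
    simpleMean y σ n * (2 * ((n : ℝ)⁻¹ * ((y * σ) * (2 * (y * σ) + 1 : ℕ) ^ (y * σ)))) := by
  have hmain := abs_occ_recursion_le (simpleTiles y σ n) (fun α => pairs α.2) forced
    (ε := (n : ℝ)⁻¹ * ((y * σ) * (2 * (y * σ) + 1 : ℕ) ^ (y * σ))) ?_ ?_ ?_ k
  · rw [Fintype.card_fin] at hmain
    exact hmain
  · intro α hα
    have hα' := mem_simpleTiles.1 hα
    refine (Finset.sum_le_sum fun β hβ => prob_mono fun f hf =>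
      (⟨mem_simpleTiles.1 hβ, hf⟩ : IsSimple β ∧ _)).trans
      (sum_prob_tile_le _ _ (card_image_tile_le α) (fun β => ?_) (simpleTiles y σ n))
    by_cases hc : ∃ f, IsSimple β ∧ β ≠ α ∧ ¬ Disjoint (pairs α.2) (pairs β.2) ∧
        ∀ u ∈ pairs β.2, (pairs α.2).piecewise (forced α) f u = forced β u
    · obtain ⟨f, hβ, hne, hd, hf⟩ := hc
      refine (prob_le_of_agree (pairs β.2 \ pairs α.2) _ ?_).trans ?_
      · rintro f f' ⟨-, -, -, h⟩ ⟨-, -, -, h'⟩ u hu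
        rw [Finset.mem_sdiff] at hu
        have := (h u hu.1).trans (h' u hu.1).symm
        simpa [hu.2] using this
      · rw [Fintype.card_fin]
        refine inv_pow_le_of_lt (hα'.card_image_sdiff_lt hβ hne hd
          (f := (pairs α.2).piecewise (forced α) f) ?_ ((agree_forced_iff hβ.2.1 _).1 hf))
        exact (agree_forced_iff hα'.2.1 _).1 fun u hu => by simp [hu]
    · rw [prob_false fun f hf => hc ⟨f, hf⟩]
      positivity
  · intro α hα
    refine sum_prob_tile_le (fun β f =>
      ¬ Disjoint (pairs α.2) (pairs β.2) ∧ ∀ u ∈ pairs β.2, f u = forced β u) _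
      (card_image_tile_le α) (fun β => ?_) (simpleTiles y σ n)
    by_cases hd : Disjoint (pairs α.2) (pairs β.2)
    · rw [prob_false fun f hf => hf.1 hd]
      positivity
    · refine (prob_le_of_agree (pairs β.2) _ ?_).trans ?_
      · rintro f f' ⟨-, h⟩ ⟨-, h'⟩ u hu
        exact (h u hu).trans (h' u hu).symm
      · rw [Fintype.card_fin]
        refine inv_pow_le_of_lt (lt_of_lt_of_le ?_ (card_image_le_card_pairs β.2))
        obtain ⟨i, j, hij⟩ := exists_eq_of_not_disjoint_pairs hd
        -- Here all pairs of `β` are prescribed, while the state shared with `α` is not new.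
        refine Finset.card_lt_card ⟨Finset.sdiff_subset, fun hsub => ?_⟩
        have := hsub (mem_image_of_mem β.2 (mem_univ i))
        simp [hij] at this
  · intro α _
    exact ⟨_, mem_pairs.2 ⟨(0, 0), rfl⟩⟩

/-- Some periodic tile solving `f` contains more pairs of neighbors than states. -/
def HasExcessTile (y σ : ℕ) [NeZero σ] {n : ℕ} (f : Rule n) : Prop :=
  ∃ k < y, ∃ g : TileIndex k σ → Fin n, Solves 0 f g ∧ #(Finset.univ.image g) < #(pairs g)

theorem prob_hasExcessTile_le (y σ n : ℕ) [NeZero σ] :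
    prob (fun f : Rule n => HasExcessTile y σ f) ≤
      (n : ℝ)⁻¹ * ((y * σ) * (2 * (y * σ) + 1 : ℕ) ^ (y * σ)) := by
  let P : Tile y σ n → Rule n → Prop := fun β f =>
    #(Finset.univ.image β.2) < #(pairs β.2) ∧ Solves 0 f β.2
  refine (prob_mono (Q := fun f => ∃ β ∈ Finset.univ, P β f) ?_).trans
    ((prob_exists_le _ _).trans (sum_prob_tile_le P ∅ (by simp) (fun β => ?_) Finset.univ))
  · rintro f ⟨k, hk, g, hg, hlt⟩
    exact ⟨⟨(⟨k, hk⟩, 0), g⟩, mem_univ _, hlt, hg⟩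
  · by_cases hlt : #(Finset.univ.image β.2) < #(pairs β.2)
    · refine (prob_le_of_agree (pairs β.2) _ ?_).trans ?_
      · rintro f f' ⟨-, h⟩ ⟨-, h'⟩ u hu
        obtain ⟨i, rfl⟩ := mem_pairs.1 hu
        rw [h, h']
      · rw [Fintype.card_fin, Finset.sdiff_empty]
        exact inv_pow_le_of_lt hlt
    · rw [prob_false fun f hf => hlt hf.1]
      positivity

end Simple

/-! ### Periodic solutions versus simple tiles -/

section Solutions

variable {y σ n : ℕ} [NeZero σ]

/-- A simple tile solving `f` yields a periodic solution. -/
theorem IsSimple.exists_periodicSolution {α : Tile y σ n} (hα : IsSimple α) {f : Rule n}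
    (hf : Solves α.1.2 f α.2) : ∃ τ ≤ y, (periodicSolutions f τ σ).Nonempty := by
  obtain ⟨⟨k, r⟩, a⟩ := α
  obtain ⟨hy, ha, -⟩ := hα
  dsimp only at *
  have hinj : ∀ t x t' x', a (tileAt r t x) = a (tileAt r t' x') →
      t % (k + 1) = t' % (k + 1) ∧ x + (t / (k + 1)) • r = x' + (t' / (k + 1)) • r := by
    intro t x t' x' h
    have := ha h
    simpa only [tileAt, Prod.mk.injEq, Fin.mk.injEq] using this
  -- The period is `(k + 1) * addOrderOf r`: each cycle of `k + 1` steps rotates by `r`.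
  -- Distinctness of the states makes both periods minimal.
  refine ⟨_, hy, fun t x => a (tileAt r t x), ?_, ?_, ?_⟩
  · intro t
    funext x
    dsimp only [step]
    rw [← down_tileAt, ← hf, left_tileAt]
    simp
  · refine ⟨⟨NeZero.pos σ, fun x => by simp⟩, ?_⟩
    rintro p ⟨hp, hp'⟩
    have := (hinj _ _ _ _ (hp' 0)).2
    simp only [Nat.zero_div, zero_smul, add_zero, Int.cast_zero, zero_add, Int.cast_natCast] at this
    exact Nat.le_of_dvd hp ((ZMod.natCast_eq_zero_iff _ _).1 this.symm)
  · refine ⟨⟨Nat.mul_pos k.1.succ_pos (addOrderOf_pos r), ?_⟩, ?_⟩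
    · funext x
      dsimp only
      congr 1
      simp [tileAt, Nat.mul_div_cancel_left _ (Nat.succ_pos k), -nsmul_eq_mul,
        addOrderOf_nsmul_eq_zero]
    · rintro q ⟨hq, hq'⟩
      have := hinj _ _ _ _ (congrFun hq' 0)
      simp only [Int.cast_zero, zero_add, Nat.zero_div, Nat.zero_mod, zero_smul] at this
      obtain ⟨c, rfl⟩ := Nat.dvd_of_mod_eq_zero this.1
      rw [Nat.mul_div_cancel_left _ (Nat.succ_pos k)] at this
      exact Nat.mul_le_mul_left _ (Nat.le_of_dvd (Nat.pos_of_mul_pos_left hq)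
        (addOrderOf_dvd_of_nsmul_eq_zero this.2))

omit [NeZero σ] in
theorem eq_of_periodic_of_intCast_eq {X : Type*} {g : ℤ → X} (hg : ∀ x, g (x + σ) = g x) {x z : ℤ}
    (h : (x : ZMod σ) = z) : g x = g z := by
  obtain ⟨c, hc⟩ := (ZMod.intCast_eq_intCast_iff_dvd_sub x z σ).1 h
  have hz : z = x + c * σ := by linarith
  rw [hz]
  exact (Function.Periodic.int_mul (f := g) (c := (σ : ℤ)) hg c x).symm

omit [NeZero σ] in
/-- A trajectory along which states determine their neighbors and predecessors contains a simple
tile. -/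
theorem exists_isSimple_of_rigid {f : Rule n} {ζ : ℕ → ℤ → Fin n}
    (hstep : ∀ t x, ζ (t + 1) x = f (ζ t (x - 1), ζ t x))
    (hper : ∀ t x, ζ t (x + σ) = ζ t x)
    (hshift : ∀ t s x z, ζ t x = ζ s z → ∀ d, ζ t (x + d) = ζ s (z + d))
    (htime : ∀ t s u x z, ζ (t + u) x = ζ (s + u) z ↔ ζ t x = ζ s z)
    (hsp : ∀ x z, ζ 0 x = ζ 0 z → (x : ZMod σ) = z)
    {τ : ℕ} (hτ : 0 < τ) (hτy : τ ≤ y) (hτ0 : ζ τ 0 = ζ 0 0) (hmin : ∀ t x, ζ 0 0 ≤ ζ t x) :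
    ∃ α : Tile y σ n, IsSimple α ∧ Solves α.1.2 f α.2 := by
  classical
  -- The first time `m` at which the state at the origin reappears anywhere is the number of rows of
  -- the tile; the place `z` of its return gives the rotation `-z`.
  have hex : ∃ m, 0 < m ∧ ∃ z, ζ m z = ζ 0 0 := ⟨τ, hτ, 0, hτ0⟩
  obtain ⟨hm, z, hz⟩ := Nat.find_spec hex
  have hleast : ∀ s z, s < Nat.find hex → ζ s z = ζ 0 0 → s = 0 := by
    intro s z hs h
    by_contra h0
    exact Nat.find_min hex hs ⟨Nat.pos_of_ne_zero h0, z, h⟩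
  have hmτ : Nat.find hex ≤ τ := Nat.find_min' hex ⟨hτ, 0, hτ0⟩
  generalize Nat.find hex = m at *
  obtain ⟨k, rfl⟩ := Nat.exists_eq_succ_of_ne_zero hm.ne'
  rw [Nat.succ_eq_add_one] at *
  have hrot : ∀ x, ζ (k + 1) x = ζ 0 (x + -z) := by
    intro x
    have := hshift _ _ _ _ hz (x + -z)
    rwa [zero_add, show z + (x + -z) = x by ring] at this
  have hrow : ∀ q s x, ζ ((k + 1) * q + s) x = ζ s (x + q • (-z)) := by
    intro q s
    induction q with
    | zero => simp
    | succ q ih =>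
      intro x
      have h1 : ζ ((k + 1) + ((k + 1) * q + s)) x = ζ (0 + ((k + 1) * q + s)) (x + -z) :=
        (htime _ _ _ _ _).2 (hrot x)
      rw [show (k + 1) * (q + 1) + s = (k + 1) + ((k + 1) * q + s) by ring, h1, zero_add, ih,
        add_smul, one_smul, add_assoc, add_comm (-z)]
  set r : ZMod σ := ((-z : ℤ) : ZMod σ) with hr
  let a : TileIndex k σ → Fin n := fun i => ζ i.1 (i.2.cast : ℤ)
  have hat : ∀ t (x : ℤ), a (tileAt r t x) = ζ t x := by
    intro t x
    conv_rhs => rw [← Nat.div_add_mod t (k + 1), hrow]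
    refine eq_of_periodic_of_intCast_eq (hper _) ?_
    rw [ZMod.intCast_zmod_cast]
    dsimp only [tileAt]
    generalize t / (k + 1) = q
    simp [hr]
  have hi : ∀ i : TileIndex k σ, i = tileAt r i.1 ((i.2.cast : ℤ) : ZMod σ) := by
    intro i
    rw [ZMod.intCast_zmod_cast, tileAt_fst_snd]
  have hinj : ∀ (s e : ℕ) (x x' : ℤ), s + e < k + 1 → ζ s x = ζ (s + e) x' →
      e = 0 ∧ (x : ZMod σ) = x' := by
    intro s e x x' hlt h
    have h1 : ζ 0 x = ζ e x' := by
      rw [← htime 0 e s, zero_add, h, add_comm]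
    have h2 := hshift _ _ _ _ h1 (-x)
    rw [add_neg_cancel] at h2
    have he := hleast e _ (by omega) h2.symm
    subst he
    exact ⟨rfl, hsp _ _ h1⟩
  refine ⟨⟨(⟨k, by omega⟩, r), a⟩, ⟨?_, ?_, ?_⟩, ?_⟩
  · dsimp only
    have hdm := Nat.div_add_mod τ (k + 1)
    have h1 := hτ0
    rw [← hdm, hrow] at h1
    have h2 := hleast _ _ (Nat.mod_lt _ k.succ_pos) h1
    rw [h2, add_zero] at hdm
    rw [h2] at h1
    have h3 : (τ / (k + 1)) • r = 0 := by
      have := hsp _ _ h1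
      generalize τ / (k + 1) = q at this
      simpa [hr] using this
    have hpos : 0 < τ / (k + 1) := Nat.div_pos hmτ k.succ_pos
    calc (k + 1) * addOrderOf r ≤ (k + 1) * (τ / (k + 1)) :=
          Nat.mul_le_mul_left _ (Nat.le_of_dvd hpos (addOrderOf_dvd_of_nsmul_eq_zero h3))
      _ = τ := hdm
      _ ≤ y := hτy
  · intro i j hij
    dsimp only [a] at hij i j
    rcases le_total (i.1 : ℕ) j.1 with hle | hle
    · obtain ⟨e, he⟩ := Nat.exists_eq_add_of_le hle
      rw [he] at hij
      obtain ⟨h0, h⟩ := hinj _ _ _ _ (he ▸ j.1.2) hij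
      rw [ZMod.intCast_zmod_cast, ZMod.intCast_zmod_cast] at h
      exact Prod.ext (Fin.ext (by omega)) h
    · obtain ⟨e, he⟩ := Nat.exists_eq_add_of_le hle
      rw [he] at hij
      obtain ⟨h0, h⟩ := hinj _ _ _ _ (he ▸ i.1.2) hij.symm
      rw [ZMod.intCast_zmod_cast, ZMod.intCast_zmod_cast] at h
      exact Prod.ext (Fin.ext (by omega)) h.symm
  · intro i
    have : a (0, 0) = ζ 0 0 := by
      have := hat 0 0
      rwa [tileAt_of_lt r k.succ_pos, Int.cast_zero] at this
    exact this.trans_le (hmin _ _)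
  · intro i
    have e := hi i
    generalize (i.1 : ℕ) = t at e
    generalize (i.2.cast : ℤ) = x at e
    subst e
    dsimp only
    rw [left_tileAt, down_tileAt, ← Int.cast_one, ← Int.cast_sub, hat, hat, hat, hstep]

/-- Both coordinate projections and `f` map the pairs onto the states. With equally many pairs and
states, all three maps are injective on the pairs. -/
theorem Solves.rigid {k : ℕ} {r : ZMod σ} {f : Rule n} {g : TileIndex k σ → Fin n}
    (h : Solves r f g) (hcard : #(pairs g) ≤ #(Finset.univ.image g)) (i j : TileIndex k σ) :
    (g i = g j → g (left i) = g (left j)) ∧ (g (left i) = g (left j) → g i = g j) ∧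
      (g (down r i) = g (down r j) → g i = g j) := by
  have hcard : #(Finset.univ.image g) = #(pairs g) :=
    le_antisymm (card_image_le_card_pairs g) hcard
  have h1 := injOn_of_card_image_eq ((congrArg card (image_snd_pairs g)).trans hcard)
  have h2 := injOn_of_card_image_eq ((congrArg card (image_fst_pairs g)).trans hcard)
  have h3 := injOn_of_card_image_eq ((congrArg card h.image_pairs).trans hcard)
  have hi : (g (left i), g i) ∈ pairs g := mem_pairs.2 ⟨i, rfl⟩
  have hj : (g (left j), g j) ∈ pairs g := mem_pairs.2 ⟨j, rfl⟩
  refine ⟨fun e => (Prod.ext_iff.1 (h1 hi hj e)).1, fun e => (Prod.ext_iff.1 (h2 hi hj e)).2,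
    fun e => (Prod.ext_iff.1 (h3 hi hj ?_)).2⟩
  rw [h, h, e]

/-- A periodic solution of a rule without excess tiles yields a simple tile. -/
theorem exists_isSimple_of_periodicSolution {f : Rule n} (hf : ¬ HasExcessTile y σ f) {τ : ℕ}
    (hτy : τ ≤ y) (hne : (periodicSolutions f τ σ).Nonempty) :
    ∃ α : Tile y σ n, IsSimple α ∧ Solves α.1.2 f α.2 := by
  obtain ⟨η, hη, ⟨⟨-, hσ⟩, hσmin⟩, ⟨hτ, hητ⟩, -⟩ := hne
  obtain ⟨k, rfl⟩ := Nat.exists_eq_succ_of_ne_zero hτ.ne'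
  rw [Nat.succ_eq_add_one] at *
  have hstep : ∀ t x, η (t + 1) x = f (η t (x - 1), η t x) := fun t x => by rw [hη]; rfl
  have hper : ∀ t x, η t (x + σ) = η t x := by
    intro t
    induction t with
    | zero => exact fun x => (hσ x).symm
    | succ t ih =>
      intro x
      rw [hstep, hstep, ih, ← ih (x - 1)]
      congr 3
      ring
  have htper : ∀ t, η (t + (k + 1)) = η t := by
    intro t
    induction t with
    | zero => rw [zero_add, hητ]
    | succ t ih => rw [add_right_comm, hη, ih, hη]
  have hmod : ∀ t, η (t % (k + 1)) = η t := fun t =>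
    Function.Periodic.map_mod_nat htper t
  -- A full temporal period is a tile without rotation; its states may still repeat.
  let g : TileIndex k σ → Fin n := fun i => η i.1 (i.2.cast : ℤ)
  have hat : ∀ t (x : ℤ), g (tileAt 0 t x) = η t x := by
    intro t x
    rw [← hmod t]
    refine eq_of_periodic_of_intCast_eq (hper _) ?_
    simp [tileAt]
  have hg : Solves 0 f g := by
    intro i
    have e : i = tileAt 0 i.1 ((i.2.cast : ℤ) : ZMod σ) := by
      rw [ZMod.intCast_zmod_cast, tileAt_fst_snd]
    generalize (i.1 : ℕ) = t at e
    generalize (i.2.cast : ℤ) = x at e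
    subst e
    rw [left_tileAt, down_tileAt, ← Int.cast_one, ← Int.cast_sub, hat, hat, hat, hstep]
  have hcard : #(pairs g) ≤ #(Finset.univ.image g) := by
    by_contra! hlt
    exact hf ⟨k, hτy, g, hg, hlt⟩
  have hrig : ∀ t x s z, (η t x = η s z → η t (x - 1) = η s (z - 1)) ∧
      (η t (x - 1) = η s (z - 1) → η t x = η s z) ∧
      (η (t + 1) x = η (s + 1) z → η t x = η s z) := by
    intro t x s z
    have := hg.rigid hcard (tileAt 0 t x) (tileAt 0 s z)
    rwa [left_tileAt, left_tileAt, down_tileAt, down_tileAt, ← Int.cast_one, ← Int.cast_sub,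
      ← Int.cast_sub, hat, hat, hat, hat, hat, hat] at this
  have hshift : ∀ t s x z, η t x = η s z → ∀ d : ℤ, η t (x + d) = η s (z + d) := by
    intro t s x z h d
    induction d using Int.induction_on with
    | zero => simpa using h
    | succ d ih =>
      refine (hrig _ _ _ _).2.1 ?_
      simpa [← add_assoc] using ih
    | pred d ih =>
      have := (hrig _ _ _ _).1 ih
      simpa [add_sub_assoc] using this
  have htime : ∀ t s u x z, η (t + u) x = η (s + u) z ↔ η t x = η s z := by
    intro t s u x z
    induction u with
    | zero => rfl
    | succ u ih =>
      rw [← ih, ← add_assoc, ← add_assoc]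
      refine ⟨(hrig _ _ _ _).2.2, fun h => ?_⟩
      rw [hstep, hstep, h, (hrig _ _ _ _).1 h]
  have hsp : ∀ x z, η 0 x = η 0 z → (x : ZMod σ) = z := by
    intro x z h
    rw [ZMod.intCast_eq_intCast_iff_dvd_sub]
    have hσ0 : (0 : ℤ) < σ := by exact_mod_cast NeZero.pos σ
    have hnn := Int.emod_nonneg (z - x) hσ0.ne'
    have hlt := Int.emod_lt_of_pos (z - x) hσ0
    by_contra hd
    have hpos : 0 < (z - x) % σ := lt_of_le_of_ne hnn fun h0 => hd (Int.dvd_of_emod_eq_zero h0.symm)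
    obtain ⟨p, hp⟩ := Int.eq_ofNat_of_zero_le hnn
    -- A repeated state in the first row makes that row periodic under the displacement, hence under
    -- its remainder `p` modulo `σ`; minimality of `σ` excludes `0 < p < σ`.
    have hle : σ ≤ p := by
      refine hσmin ⟨by omega, fun w => ?_⟩
      have h1 := hshift _ _ _ _ h (w - x)
      rw [add_sub_cancel] at h1
      rw [h1]
      refine eq_of_periodic_of_intCast_eq (hper 0) ?_
      rw [← hp, ZMod.intCast_eq_intCast_iff_dvd_sub]
      have : w + (z - x) % σ - (z + (w - x)) = (z - x) % σ - (z - x) := by ring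
      rw [this]
      exact ⟨-((z - x) / σ), by have := Int.emod_add_mul_ediv (z - x) σ; linarith⟩
    omega
  -- Moving the space-time origin to a smallest state provides the normalization of simple tiles.
  obtain ⟨i₀, hi₀⟩ := Finite.exists_min g
  have hmin : ∀ t x, g i₀ ≤ η t x := fun t x => hat t x ▸ hi₀ _
  refine exists_isSimple_of_rigid (ζ := fun t x => η (t + i₀.1) (x + (i₀.2.cast : ℤ))) (τ := k + 1)
    ?_ ?_ ?_ ?_ ?_ hτ hτy ?_ ?_
  · intro t x
    rw [add_right_comm, hstep]
    congr 3
    ring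
  · intro t x
    rw [add_right_comm, hper]
  · intro t s x z h d
    rw [add_right_comm, hshift _ _ _ _ h, add_right_comm]
  · intro t s u x z
    rw [add_right_comm, add_right_comm s, htime]
  · intro x z h
    have := hsp _ _ ((htime _ _ _ _ _).1 h)
    simpa using this
  · rw [add_comm (k + 1), htper, zero_add, zero_add]
  · intro t x
    rw [zero_add, zero_add]
    exact hmin _ _

omit [NeZero σ] in
theorem minTemporalPeriod_le_iff {f : Rule n} :
    minTemporalPeriod σ n f ≤ y ↔ ∃ τ ≤ y, (periodicSolutions f τ σ).Nonempty := by
  constructor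
  · intro h
    have hne : {t : ℕ∞ | ∃ τ : ℕ, t = τ ∧ (periodicSolutions f τ σ).Nonempty}.Nonempty := by
      by_contra hne
      rw [Set.not_nonempty_iff_eq_empty] at hne
      rw [minTemporalPeriod, hne, sInf_empty, top_le_iff] at h
      exact ENat.natCast_ne_top _ h
    obtain ⟨τ, hτ, hs⟩ := csInf_mem hne
    refine ⟨τ, ?_, hs⟩
    rw [minTemporalPeriod, hτ] at h
    exact_mod_cast h
  · rintro ⟨τ, hτ, hs⟩
    have hle : minTemporalPeriod σ n f ≤ τ := sInf_le ⟨τ, rfl, hs⟩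
    exact hle.trans (by exact_mod_cast hτ)

theorem simpleCount_ne_zero_iff {f : Rule n} :
    simpleCount y σ f ≠ 0 ↔ ∃ α : Tile y σ n, IsSimple α ∧ Solves α.1.2 f α.2 := by
  rw [simpleCount, ne_eq, occ_eq_zero_iff]
  push Not
  simp only [mem_simpleTiles]
  exact exists_congr fun α => and_congr_right fun hα => agree_forced_iff hα.2.1 f

theorem minTemporalPeriod_le_of_simpleCount_ne_zero {f : Rule n} (h : simpleCount y σ f ≠ 0) :
    minTemporalPeriod σ n f ≤ y := by
  obtain ⟨α, hα, hf⟩ := simpleCount_ne_zero_iff.1 h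
  exact minTemporalPeriod_le_iff.2 (hα.exists_periodicSolution hf)

theorem simpleCount_ne_zero_or_hasExcessTile {f : Rule n} (h : minTemporalPeriod σ n f ≤ y) :
    simpleCount y σ f ≠ 0 ∨ HasExcessTile y σ f := by
  refine or_iff_not_imp_right.2 fun hf => simpleCount_ne_zero_iff.2 ?_
  obtain ⟨τ, hτ, hs⟩ := minTemporalPeriod_le_iff.1 h
  exact exists_isSimple_of_periodicSolution hf hτ hs

end Solutions

/-! ### The limiting mean number of simple tiles -/

section Rate

variable (y σ : ℕ) [NeZero σ]

/-- An injective map attains its minimum at exactly one index, and by symmetry all indices are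
equally frequent. -/
theorem card_injective_min_mul {ι : Type*} [Fintype ι] [DecidableEq ι] (n : ℕ) (i₀ : ι) :
    #{a : ι → Fin n | Function.Injective a ∧ ∀ i, a i₀ ≤ a i} * Fintype.card ι =
      n.descFactorial (Fintype.card ι) := by
  have hcard : #{a : ι → Fin n | Function.Injective a} = n.descFactorial (Fintype.card ι) := by
    rw [← Fintype.card_subtype,
      Fintype.card_congr (Equiv.subtypeInjectiveEquivEmbedding ι (Fin n)),
      Fintype.card_embedding_eq, Fintype.card_fin]
  have hsymm : ∀ j, #{a : ι → Fin n | Function.Injective a ∧ ∀ i, a j ≤ a i} =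
      #{a : ι → Fin n | Function.Injective a ∧ ∀ i, a i₀ ≤ a i} := by
    intro j
    refine card_nbij' (fun a => a ∘ Equiv.swap i₀ j) (fun a => a ∘ Equiv.swap i₀ j) ?_ ?_ ?_ ?_
    · intro a ha
      simp only [coe_filter, mem_univ, true_and, Set.mem_ofPred_eq] at ha ⊢
      exact ⟨ha.1.comp (Equiv.injective _), fun i => by simpa using ha.2 _⟩
    · intro a ha
      simp only [coe_filter, mem_univ, true_and, Set.mem_ofPred_eq] at ha ⊢
      exact ⟨ha.1.comp (Equiv.injective _), fun i => by simpa using ha.2 _⟩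
    · intro a _
      funext i
      simp
    · intro a _
      funext i
      simp
  have : Nonempty ι := ⟨i₀⟩
  calc #{a : ι → Fin n | Function.Injective a ∧ ∀ i, a i₀ ≤ a i} * Fintype.card ι
      = ∑ j : ι, #{a : ι → Fin n | Function.Injective a ∧ ∀ i, a j ≤ a i} := by
        simp [hsymm, mul_comm]
    _ = ∑ j : ι, ∑ a : ι → Fin n with Function.Injective a, if ∀ i, a j ≤ a i then 1 else 0 := by
        simp only [card_filter, Finset.sum_filter, ite_and]
    _ = ∑ a : ι → Fin n with Function.Injective a, 1 := by
        rw [Finset.sum_comm]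
        refine Finset.sum_congr rfl fun a ha => ?_
        rw [← card_filter, card_eq_one]
        obtain ⟨j, hj⟩ := Finite.exists_min a
        refine ⟨j, ?_⟩
        ext l
        simp only [mem_filter, mem_univ, true_and, mem_singleton]
        refine ⟨fun h => (mem_filter.1 ha).2 (le_antisymm (h j) (hj l)), ?_⟩
        rintro rfl
        exact hj
    _ = _ := by rw [← hcard, card_eq_sum_ones]

theorem simpleMean_eq (n : ℕ) :
    simpleMean y σ n = ∑ q : Fin y × ZMod σ, if (q.1 + 1) * addOrderOf q.2 ≤ y then
      (1 / (((q.1 : ℕ) + 1) * σ) : ℝ) *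
        ((n.descFactorial ((q.1 + 1) * σ) : ℝ) / (n : ℝ) ^ ((q.1 + 1) * σ)) else 0 := by
  classical
  have h1 : ∀ α ∈ simpleTiles y σ n, ((n : ℝ)⁻¹) ^ #(pairs α.2) =
      ((n : ℝ)⁻¹) ^ ((α.1.1 + 1) * σ) := fun α hα => by
    rw [card_pairs_of_injective (mem_simpleTiles.1 hα).2.1]
  rw [simpleMean, Finset.sum_congr rfl h1, simpleTiles, Finset.sum_filter, Fintype.sum_sigma]
  refine Finset.sum_congr rfl fun q _ => ?_
  simp only [IsSimple]
  split_ifs with hq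
  · simp only [hq, true_and]
    rw [← Finset.sum_filter, Finset.sum_const, nsmul_eq_mul]
    have h2 := card_injective_min_mul n ((0, 0) : TileIndex q.1 σ)
    simp only [Fintype.card_prod, Fintype.card_fin, ZMod.card] at h2
    rw [← h2]
    have hσ : (σ : ℝ) ≠ 0 := NeZero.ne _
    have hk : ((q.1 : ℕ) : ℝ) + 1 ≠ 0 := by positivity
    push_cast
    rw [inv_pow]
    field_simp
  · simp [hq]

theorem sum_addOrderOf_dvd (τ : ℕ) (hτ : τ ≠ 0) :
    ∑ r : ZMod σ, (if addOrderOf r ∣ τ then (addOrderOf r : ℝ) else 0) =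
      ∑ d ∈ (Nat.gcd τ σ).divisors, (Nat.totient d : ℝ) * (d : ℝ) := by
  rw [← Finset.sum_filter, ← Finset.sum_fiberwise_of_maps_to (t := (Nat.gcd τ σ).divisors)
    (g := fun r => addOrderOf r)]
  · refine Finset.sum_congr rfl fun d hd => ?_
    rw [Nat.mem_divisors, Nat.dvd_gcd_iff] at hd
    have hc : #{r : ZMod σ | addOrderOf r = d} = d.totient :=
      IsAddCyclic.card_addOrderOf_eq_totient (by rw [ZMod.card]; exact hd.1.2)
    rw [← hc, filter_filter, Finset.sum_congr rfl (g := fun _ => (d : ℝ)) (by simp +contextual),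
      Finset.sum_const, nsmul_eq_mul]
    congr 3
    ext r
    simp only [mem_filter, mem_univ, true_and, and_iff_right_iff_imp]
    rintro rfl
    exact hd.1.1
  · intro r hr
    rw [Nat.mem_divisors, Nat.dvd_gcd_iff]
    refine ⟨⟨(mem_filter.1 hr).2, ?_⟩, Nat.gcd_ne_zero_left hτ⟩
    simpa [ZMod.card] using addOrderOf_dvd_card (x := r)

omit [NeZero σ] in
theorem sum_fin_mul_le_eq {o : ℕ} (ho : 0 < o) :
    ∑ k : Fin y, (if ((k : ℕ) + 1) * o ≤ y then (1 / (((k : ℕ) + 1) * σ) : ℝ) else 0) =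
      ∑ τ ∈ Finset.Icc 1 y, if o ∣ τ then (o : ℝ) / (τ * σ) else 0 := by
  rw [Fin.sum_univ_eq_sum_range
    (fun k => if (k + 1) * o ≤ y then (1 / (((k : ℕ) + 1) * σ) : ℝ) else 0) y,
    ← Finset.sum_filter, ← Finset.sum_filter]
  -- Index `k` stands for `k + 1` rows, so a rotation of order `o` gives the period `τ = (k + 1) *
  -- o`.
  refine Finset.sum_nbij' (fun k => (k + 1) * o) (fun τ => τ / o - 1) ?_ ?_ ?_ ?_ ?_
  · intro k hk
    simp only [mem_filter, Finset.mem_range, Finset.mem_Icc] at hk ⊢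
    exact ⟨⟨Nat.mul_pos k.succ_pos ho, hk.2⟩, Dvd.intro_left _ rfl⟩
  · intro τ hτ
    simp only [mem_filter, Finset.mem_range, Finset.mem_Icc] at hτ ⊢
    obtain ⟨⟨h1, h2⟩, c, rfl⟩ := hτ
    have hc : 0 < c := Nat.pos_of_mul_pos_left h1
    rw [Nat.mul_div_cancel_left _ ho, Nat.sub_add_cancel hc, mul_comm c]
    have := Nat.le_mul_of_pos_left c ho
    exact ⟨by omega, h2⟩
  · intro k _
    simp [Nat.mul_div_cancel _ ho]
  · intro τ hτ
    simp only [mem_filter, Finset.mem_Icc] at hτ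
    obtain ⟨⟨h1, h2⟩, c, rfl⟩ := hτ
    have hc : 0 < c := Nat.pos_of_mul_pos_left h1
    rw [Nat.mul_div_cancel_left _ ho, Nat.sub_add_cancel hc, mul_comm c]
  · intro k _
    have : (o : ℝ) ≠ 0 := by positivity
    push_cast
    field_simp

theorem sum_periodRate_eq :
    ∑ q : Fin y × ZMod σ, (if (q.1 + 1) * addOrderOf q.2 ≤ y then
      (1 / (((q.1 : ℕ) + 1) * σ) : ℝ) else 0) = ∑ τ ∈ Finset.Icc 1 y, periodRate τ σ := by
  have hσ : (σ : ℝ) ≠ 0 := NeZero.ne _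
  have h1 : ∀ τ ∈ Finset.Icc 1 y, periodRate τ σ =
      ∑ r : ZMod σ, if addOrderOf r ∣ τ then (addOrderOf r : ℝ) / (τ * σ) else 0 := by
    intro τ hτ
    rw [periodRate, ← sum_addOrderOf_dvd σ τ (by simp at hτ; omega), Finset.mul_sum]
    refine Finset.sum_congr rfl fun r _ => ?_
    split_ifs
    · ring
    · simp
  rw [Finset.sum_congr rfl h1, Finset.sum_comm, Fintype.sum_prod_type_right]
  refine Finset.sum_congr rfl fun r _ => ?_
  exact sum_fin_mul_le_eq y σ (addOrderOf_pos r)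

theorem tendsto_simpleMean :
    Tendsto (simpleMean y σ) atTop (nhds (∑ τ ∈ Finset.Icc 1 y, periodRate τ σ)) := by
  rw [← sum_periodRate_eq, show simpleMean y σ = _ from funext (simpleMean_eq y σ)]
  refine tendsto_finsetSum _ fun q _ => ?_
  split_ifs
  · have h : Tendsto (fun n : ℕ => (n.descFactorial ((q.1 + 1) * σ) : ℝ) /
        (n : ℝ) ^ ((q.1 + 1) * σ)) atTop (nhds 1) := ?_
    · simpa using h.const_mul (1 / (((q.1 : ℕ) + 1) * σ) : ℝ)
    refine (Asymptotics.isEquivalent_iff_tendsto_one ?_).1 (isEquivalent_descFactorial _)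
    filter_upwards [eventually_gt_atTop 0] with n hn
    positivity
  · exact tendsto_const_nhds

end Rate

/-! ### Limits of the distribution functions -/

theorem ruleMeasure_real_eq_prob (n : ℕ) (P : Rule n → Prop) :
    (ruleMeasure n).real {f | P f} = prob P := by
  classical
  rw [Measure.real, ruleMeasure, uniformOn_univ, prob_eq, Fintype.expect_eq_sum_div_card,
    Measure.count_apply_finite _ (Set.toFinite _)]
  simp [ENNReal.toReal_div]

theorem tendsto_prob_simpleCount_eq_zero (y σ : ℕ) [NeZero σ] :
    Tendsto (fun n => prob (fun f : Rule n => simpleCount y σ f = 0)) atTop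
      (nhds (Real.exp (-∑ τ ∈ Finset.Icc 1 y, periodRate τ σ))) := by
  have hL := tendsto_simpleMean y σ
  refine tendsto_exp_neg_of_recursion
    (p := fun n k => prob (fun f : Rule n => simpleCount y σ f = k))
    (fun n k => prob_nonneg _) hL (fun k => ?_) (fun n K => ?_) (fun n K => ?_)
  · refine squeeze_zero_norm (fun n => abs_simpleCount_recursion_le y σ n k) ?_
    have h := hL.mul (((tendsto_inv_atTop_nhds_zero_nat (𝕜 := ℝ)).mul_const
      ((y * σ) * (2 * (y * σ) + 1 : ℕ) ^ (y * σ) : ℝ)).const_mul 2)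
    simpa using h
  · have h := one_sub_le_sum_prob_occ (simpleTiles y σ n) (fun α => pairs α.2) forced K
    rw [Fintype.card_fin] at h
    exact h
  · exact sum_prob_occ_le (simpleTiles y σ n) (fun α => pairs α.2) forced K

theorem prob_not {Ω : Type*} [Fintype Ω] [Nonempty Ω] (P : Ω → Prop) :
    prob (fun f => ¬ P f) = 1 - prob P := by
  classical
  rw [eq_sub_iff_add_eq, prob_eq, prob_eq, ← Finset.expect_add_distrib,
    ← Fintype.expect_const (ι := Ω) (1 : ℝ)]
  refine Finset.expect_congr rfl fun f _ => ?_
  by_cases h : P f <;> simp [h]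

theorem prob_or_le {Ω : Type*} [Fintype Ω] (P Q : Ω → Prop) :
    prob (fun f => P f ∨ Q f) ≤ prob P + prob Q := by
  classical
  rw [prob_eq, prob_eq, prob_eq, ← Finset.expect_add_distrib]
  refine Finset.expect_le_expect fun f _ => ?_
  by_cases h : P f <;> by_cases h' : Q f <;> simp [h, h']

/-- A sandwich: a simple tile forces a short period, and a short period without a simple tile forces
an excess tile, of probability `O(1 / n)`. -/
theorem tendsto_prob_minTemporalPeriod_le (y σ : ℕ) [NeZero σ] :
    Tendsto (fun n => prob (fun f : Rule n => minTemporalPeriod σ n f ≤ y)) atTop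
      (nhds (1 - Real.exp (-∑ τ ∈ Finset.Icc 1 y, periodRate τ σ))) := by
  have h0 := (tendsto_prob_simpleCount_eq_zero y σ).const_sub 1
  have h1 := (tendsto_inv_atTop_nhds_zero_nat (𝕜 := ℝ)).mul_const
    ((y * σ) * (2 * (y * σ) + 1 : ℕ) ^ (y * σ) : ℝ)
  have h2 := h0.add h1
  rw [zero_mul, add_zero] at h2
  refine tendsto_of_tendsto_of_tendsto_of_le_of_le h0 h2 (fun n => ?_) (fun n => ?_)
  · dsimp only
    rw [← prob_not]
    exact prob_mono fun f hf => minTemporalPeriod_le_of_simpleCount_ne_zero hf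
  · dsimp only
    rw [← prob_not]
    exact (prob_mono fun f hf => simpleCount_ne_zero_or_hasExcessTile hf).trans
      ((prob_or_le _ _).trans (add_le_add_right (prob_hasExcessTile_le y σ n) _))

/-! ### The limit law and weak convergence -/

theorem one_div_le_periodRate {τ σ : ℕ} (hτ : τ ≠ 0) :
    1 / ((τ : ℝ) * σ) ≤ periodRate τ σ := by
  rw [periodRate]
  refine le_mul_of_one_le_right (by positivity) ?_
  have h1 : (1 : ℕ) ∈ (Nat.gcd τ σ).divisors :=
    Nat.one_mem_divisors.2 (Nat.gcd_ne_zero_left hτ)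
  refine le_trans ?_ (Finset.single_le_sum (fun d _ => by positivity) h1)
  simp

theorem periodRate_nonneg (τ σ : ℕ) : 0 ≤ periodRate τ σ := by
  rw [periodRate]
  positivity

/-- The divisor `d = 1` alone contributes a multiple of the harmonic series. Divergence is what
makes the limit variable finite almost surely. -/
theorem tendsto_sum_periodRate (σ : ℕ) [NeZero σ] :
    Tendsto (fun y => ∑ τ ∈ Finset.Icc 1 y, periodRate τ σ) atTop atTop := by
  have hσ : (0 : ℝ) < σ := by exact_mod_cast NeZero.pos σ
  refine tendsto_atTop_mono (fun y => ?_)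
    (Real.tendsto_sum_range_one_div_nat_succ_atTop.const_mul_atTop (inv_pos.2 hσ))
  induction y with
  | zero => simp
  | succ y ih =>
    rw [Finset.sum_range_succ, mul_add, Finset.sum_Icc_succ_top (by omega)]
    refine add_le_add ih (le_trans (le_of_eq ?_) (one_div_le_periodRate y.succ_ne_zero))
    push_cast
    field_simp

/-- A monotone function on `ℕ` with limit `1` is the distribution function of a probability
measure. -/
theorem exists_isProbabilityMeasure_real_Iic {F : ℕ → ℝ} (hF : Monotone F) (h0 : 0 ≤ F 0)
    (hlim : Tendsto F atTop (nhds 1)) :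
    ∃ μ : Measure ℕ, IsProbabilityMeasure μ ∧ ∀ y, μ.real (Set.Iic y) = F y := by
  let p : ℕ → ℝ := fun k => if k = 0 then F 0 else F k - F (k - 1)
  have hp : ∀ k, 0 ≤ p k := by
    intro k
    simp only [p]
    split_ifs
    · exact h0
    · exact sub_nonneg.2 (hF (Nat.sub_le _ _))
  have hsum : ∀ K, ∑ k ∈ Finset.range (K + 1), p k = F K := by
    intro K
    induction K with
    | zero => simp [p]
    | succ K ih =>
      rw [Finset.sum_range_succ, ih]
      simp [p]
  have hs : HasSum p 1 := by
    rw [hasSum_iff_tendsto_nat_of_nonneg hp, ← tendsto_add_atTop_iff_nat 1]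
    simpa only [hsum] using hlim
  have hs' : HasSum (fun k => ENNReal.ofReal (p k)) 1 := by
    rw [← ENNReal.ofReal_one, ← hs.tsum_eq, ENNReal.ofReal_tsum_of_nonneg hp hs.summable]
    exact ENNReal.summable.hasSum
  let q : PMF ℕ := ⟨fun k => ENNReal.ofReal (p k), hs'⟩
  refine ⟨q.toMeasure, inferInstance, fun y => ?_⟩
  have : Set.Iic y = (Finset.range (y + 1) : Set ℕ) := by
    ext k
    simp
  rw [Measure.real, this, PMF.toMeasure_apply_finset]
  change (∑ k ∈ Finset.range (y + 1), ENNReal.ofReal (p k)).toReal = _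
  rw [← ENNReal.ofReal_sum_of_nonneg fun k _ => hp k, hsum, ENNReal.toReal_ofReal]
  exact h0.trans (hF (Nat.zero_le y))

/-- Convergence of distribution functions at all natural numbers implies weak convergence of
probability measures on `ℕ∞`. -/
theorem tendsto_probabilityMeasure_enat {ρ : ℕ → ProbabilityMeasure ℕ∞}
    {ν : ProbabilityMeasure ℕ∞}
    (h : ∀ y : ℕ, Tendsto (fun n => (ρ n : Measure ℕ∞).real (Set.Iic (y : ℕ∞))) atTop
      (nhds ((ν : Measure ℕ∞).real (Set.Iic (y : ℕ∞))))) :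
    Tendsto ρ atTop (nhds ν) := by
  have hIic : ∀ b : ℕ∞, Tendsto (fun n => (ρ n : Measure ℕ∞).real (Set.Iic b)) atTop
      (nhds ((ν : Measure ℕ∞).real (Set.Iic b))) := by
    intro b
    induction b using ENat.recTopCoe with
    | top => simp
    | coe b => exact h b
  have hIio : ∀ a : ℕ, Tendsto (fun n => (ρ n : Measure ℕ∞).real (Set.Iio (a : ℕ∞))) atTop
      (nhds ((ν : Measure ℕ∞).real (Set.Iio (a : ℕ∞)))) := by
    intro a
    cases a with
    | zero => simp
    | succ a =>
      have : Set.Iio ((a + 1 : ℕ) : ℕ∞) = Set.Iic (a : ℕ∞) := by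
        ext x
        simp only [Set.mem_Iio, Set.mem_Iic, Nat.cast_add, Nat.cast_one]
        exact ENat.lt_add_one_iff (ENat.natCast_ne_top a)
      rw [this]
      exact h a
  -- Intervals with finite left end are closed under intersection and give small neighborhoods of
  -- every point, including `⊤`.
  refine IsPiSystem.tendsto_probabilityMeasure_of_tendsto_of_mem
    (S := {s | ∃ (a : ℕ) (b : ℕ∞), s = Set.Icc (a : ℕ∞) b}) ?_ (fun _ _ => trivial) ?_ ?_
  · rintro _ ⟨a, b, rfl⟩ _ ⟨a', b', rfl⟩ -
    exact ⟨max a a', min b b', by rw [Set.Icc_inter_Icc]; rfl⟩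
  · intro u hu x hx
    induction x using ENat.recTopCoe with
    | top =>
      obtain ⟨l, hl, hlu⟩ := exists_Ioc_subset_of_mem_nhds (hu.mem_nhds hx) ⟨0, ENat.top_pos⟩
      lift l to ℕ using hl.ne
      have hI : Set.Icc ((l + 1 : ℕ) : ℕ∞) ⊤ = Set.Ioi (l : ℕ∞) := by
        ext x
        simp [ENat.add_one_le_iff (ENat.natCast_ne_top l)]
      refine ⟨_, ⟨l + 1, ⊤, rfl⟩, ?_, ?_⟩
      · rw [hI]
        exact isOpen_Ioi.mem_nhds hl
      · rw [hI, ← Set.Ioc_top]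
        exact hlu
    | coe k =>
      refine ⟨Set.Icc k k, ⟨k, k, rfl⟩, ?_, ?_⟩
      · rw [ENat.mem_nhds_natCast_iff]
        simp
      · rw [Set.Icc_self]
        exact Set.singleton_subset_iff.2 hx
  · rintro _ ⟨a, b, rfl⟩
    rw [← NNReal.tendsto_coe]
    change Tendsto (fun n => (ρ n : Measure ℕ∞).real (Set.Icc (a : ℕ∞) b)) atTop
      (nhds ((ν : Measure ℕ∞).real (Set.Icc (a : ℕ∞) b)))
    by_cases hab : (a : ℕ∞) ≤ b
    · have hdiff : Set.Icc (a : ℕ∞) b = Set.Iic b \ Set.Iio (a : ℕ∞) := by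
        ext x
        simp [and_comm]
      have hsub : Set.Iio (a : ℕ∞) ⊆ Set.Iic b := fun x hx => (le_of_lt hx).trans hab
      have hreal : ∀ κ : ProbabilityMeasure ℕ∞, (κ : Measure ℕ∞).real (Set.Icc (a : ℕ∞) b) =
          (κ : Measure ℕ∞).real (Set.Iic b) - (κ : Measure ℕ∞).real (Set.Iio (a : ℕ∞)) := by
        intro κ
        rw [hdiff, measureReal_sdiff hsub trivial]
      simp_rw [hreal]
      exact (hIic b).sub (hIio a)
    · simp [Set.Icc_eq_empty hab]

end RandomCA

theorem corollary1 (σ : ℕ) (hσ : 1 ≤ σ) :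
    ∃ (μ : Measure ℕ) (_ : IsProbabilityMeasure μ),
      (∀ y : ℕ, μ.real (Set.Iic y) =
        1 - Real.exp (-∑ τ ∈ Finset.Icc 1 y, RandomCA.periodRate τ σ)) ∧
      (∀ k : ℕ, μ ≠ Measure.dirac k) ∧
      TendstoInDistribution (fun n : ℕ => RandomCA.minTemporalPeriod σ n) atTop
        (fun k : ℕ => (k : ℕ∞)) RandomCA.ruleMeasure μ := by
  have : NeZero σ := ⟨by omega⟩
  let F : ℕ → ℝ := fun y => 1 - Real.exp (-∑ τ ∈ Finset.Icc 1 y, RandomCA.periodRate τ σ)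
  have hmono : Monotone F := by
    refine monotone_nat_of_le_succ fun y => ?_
    have := RandomCA.periodRate_nonneg (y + 1) σ
    simp only [F]
    rw [Finset.sum_Icc_succ_top (by omega)]
    gcongr
    linarith
  have hlim : Tendsto F atTop (nhds 1) := by
    have h := (Real.tendsto_exp_neg_atTop_nhds_zero.comp
      (RandomCA.tendsto_sum_periodRate σ)).const_sub 1
    rwa [sub_zero] at h
  obtain ⟨μ, hμ, hcdf⟩ := RandomCA.exists_isProbabilityMeasure_real_Iic hmono (by simp [F]) hlim
  replace hcdf : ∀ y : ℕ, μ.real (Set.Iic y) =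
      1 - Real.exp (-∑ τ ∈ Finset.Icc 1 y, RandomCA.periodRate τ σ) := hcdf
  refine ⟨μ, hμ, hcdf, ?_, ?_⟩
  -- A point mass at `k` has distribution function one at `k`, but the exponential is positive.
  · rintro k rfl
    have h := hcdf k
    have hpos := Real.exp_pos (-∑ τ ∈ Finset.Icc 1 k, RandomCA.periodRate τ σ)
    simp only [Measure.real, Measure.dirac_apply, Set.mem_Iic, le_refl, Set.indicator_of_mem,
      Pi.one_apply, ENNReal.toReal_one] at h
    linarith
  · have hmeas : Measurable fun k : ℕ => (k : ℕ∞) := measurable_of_countable _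
    refine ⟨fun n => (measurable_of_finite _).aemeasurable, hmeas.aemeasurable, ?_⟩
    refine RandomCA.tendsto_probabilityMeasure_enat fun y => ?_
    have h := RandomCA.tendsto_prob_minTemporalPeriod_le y σ
    rw [← hcdf y] at h
    have hlim : (μ.map fun k : ℕ => (k : ℕ∞)).real (Set.Iic (y : ℕ∞)) = μ.real (Set.Iic y) := by
      rw [map_measureReal_apply hmeas trivial]
      congr 1
      ext k
      simp
    dsimp only [ProbabilityMeasure.coe_mk]
    rw [hlim]
    refine h.congr fun n => ?_
    rw [map_measureReal_apply (measurable_of_finite _) (MeasurableSpace.measurableSet_top),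
      ← RandomCA.ruleMeasure_real_eq_prob]
    rfl
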